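/- For a Noetherian local ring $(R,\mathfrak m)$ of characteristic $p>0$, the Hilbert--Kunz multiplicity of $R$ is \[ e_{HK}(R)=\lim_{e\to\infty}\frac{\lambda_R(R/\mathfrak m^{[p^e]})}{p^{e\dim R}}, \] where $\lambda_R$ denotes length and $\mathfrak m^{[p^e]}$ is the ideal generated by the $p^e$-th powers of all elements of $\mathfrak m$. Let $d\ge 0$ be an integer. There exist polynomials $f,g\in\mathbb Q[x]$, both of degree exactly $d$ (and depending only on $d$), such that for every prime $p>2$ the limit defining the Hilbert--Kunz multiplicity of $\mathbb F_p[[x_0,\ldots,x_d]]/(x_0^2+\cdots+x_d^2)$ exists, $g(p)\neq 0$, and \[ e_{HK}\bigl(\mathbb F_p[[x_0,\ldots,x_d]]/(x_0^2+\cdots+x_d^2)\bigr)=\frac{f(p)}{g(p)}. \] (The polynomials $f$ and $g$ are not claimed to be coprime.) -/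

import Mathlib

open Filter Topology Polynomial

namespace HilbertKunz

/-- The Frobenius power `I^[q]`: the ideal generated by the `q`-th powers of all elements of `I`. -/
def frobeniusPower {R : Type*} [CommRing R] (I : Ideal R) (q : ℕ) : Ideal R :=
  Ideal.span ((fun a : R => a ^ q) '' (I : Set R))

/-- The Krull dimension as a natural number; this is the dimension of `R` whenever that is finite
and nonnegative, in particular for every Noetherian local ring. -/
noncomputable def dim (R : Type*) [CommRing R] : ℕ :=
  ((ringKrullDim R).unbotD 0).toNat

/-- For a Noetherian local ring `(R, m)` of characteristic `p > 0`, the sequence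
`e ↦ length_R (R / m^[p^e]) / p^(e * dim R)`. All these lengths are finite, because `m^[p^e]`
contains a power of `m`. -/
noncomputable def hkSeq (R : Type*) [CommRing R] [IsLocalRing R] [IsNoetherianRing R] (e : ℕ) : ℝ :=
  ((Module.length R
      (R ⧸ frobeniusPower (IsLocalRing.maximalIdeal R) (ringChar R ^ e))).toNat : ℝ) /
    (ringChar R : ℝ) ^ (e * dim R)

/-- The Hilbert--Kunz multiplicity `e_HK(R)` of a Noetherian local ring of positive characteristic: the limit
of the sequence `hkSeq R`. -/
noncomputable def eHK (R : Type*) [CommRing R] [IsLocalRing R] [IsNoetherianRing R] : ℝ :=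
  limUnder atTop (hkSeq R)

/-- The quadratic form `x_0^2 + ... + x_d^2` in `k[[x_0, ..., x_d]]`. -/
noncomputable def quadric (k : Type*) [Field k] (d : ℕ) : MvPowerSeries (Fin (d + 1)) k :=
  ∑ i : Fin (d + 1), (MvPowerSeries.X i) ^ 2

/-- The ring `k[[x_0, ..., x_d]] / (x_0^2 + ... + x_d^2)`. -/
abbrev QuadricRing (k : Type*) [Field k] (d : ℕ) : Type _ :=
  MvPowerSeries (Fin (d + 1)) k ⧸ Ideal.span {quadric k d}

theorem quadric_not_isUnit (k : Type*) [Field k] (d : ℕ) : ¬ IsUnit (quadric k d) := by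
  rw [MvPowerSeries.isUnit_iff_constantCoeff]
  simp [quadric]

instance quadricRing_nontrivial (k : Type*) [Field k] (d : ℕ) : Nontrivial (QuadricRing k d) :=
  Ideal.Quotient.nontrivial_iff.mpr fun h =>
    quadric_not_isUnit k d (Ideal.span_singleton_eq_top.mp h)

instance quadricRing_isLocalRing (k : Type*) [Field k] (d : ℕ) : IsLocalRing (QuadricRing k d) :=
  IsLocalRing.of_surjective' (Ideal.Quotient.mk (Ideal.span {quadric k d}))
    Ideal.Quotient.mk_surjective

end HilbertKunz

/-! Let k = F_p, q = p^e, p = 2m+1. The length of R/m^[q] is the k-dimension of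
k[x_0,...,x_d]/(x_0^q,...,x_d^q, Σ x_i^2). This is the number of cyclic summands of the (d+1)-st
tensor power of k[X]/(X^q), regarded as a k[T]-module with T acting as X^2 and as T⊗1+1⊗T on tensor
products. The count takes place in a representation ring in the style of Han and Monsky: formal
rational combinations of modules, modulo the radical of the block-counting form α, which makes
Krull–Schmidt unnecessary. Write δ_n for the class `dl k n` of k[T]/(T^n).

The class of the module for q = 2s+1 is x_0, and the one for pq is x_m, where x_a = δ_{qa+s} +
δ_{qa+s+1}. Since δ_q² = qδ_q, the ideal of δ_q can be killed at the price of an explicit correction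
to α. In the quotient the product formulas (`dl_mul_dl_succ`, `dl_succ_mul_dl`,
`dl_succ_mul_dl_last`) say that y = δ_{q+1} satisfies y·x_{a+1} = x_a + x_{a+1} + x_{a+2}, with
boundary relations at both ends. Hence x_m = g·x_0, where g maps symmetric pairs x_{m-c} + x_{m+c}
to combinations of such pairs with coefficients depending on m and c only. The corrected α vanishes
on x_0^d·x_a for a > 0, so α(x_m^{d+1}) = w·α(x_0^{d+1}) with w depending only on m and d.

Thus (`blocks_sq_prime_mul`) the lengths a_e satisfy a_{e+1} = p^{de}·a_1 + w(a_e - p^{de}), and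
a_e/p^{de} tends to (a_1 - w)/(p^d - w). A similar computation modulo δ_p gives a_1 = p^d + u
(`blocks_sq_prime`). Both u and w are iterated finite sums, hence polynomials in p. The bounds 0 ≤ u
≤ p^d and 0 ≤ w ≤ p^d/3 give the degrees and the nonvanishing of the denominator. -/

namespace HilbertKunz

/-! ### Finite k[T]-modules, block numbers and tensor products -/

open scoped TensorProduct

/-- A finite-dimensional commutative algebra together with a marked element, regarded as the
`k[T]`-module on which `T` acts as multiplication by that element. -/
structure MarkedAlg (k : Type) [Field k] where
  A : Type
  [ring : CommRing A]
  [alg : Algebra k A]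
  [fin : Module.Finite k A]
  t : A

attribute [instance] MarkedAlg.ring MarkedAlg.alg MarkedAlg.fin

namespace MarkedAlg

variable {k : Type} [Field k]

/-- Two marked algebras are equivalent if the associated `k[T]`-modules are isomorphic. -/
def Equivalent (M N : MarkedAlg k) : Prop :=
  ∃ e : M.A ≃ₗ[k] N.A, ∀ a, e (M.t * a) = N.t * e a

theorem Equivalent.refl (M : MarkedAlg k) : Equivalent M M :=
  ⟨LinearEquiv.refl k M.A, fun _ => rfl⟩

theorem Equivalent.symm {M N : MarkedAlg k} : Equivalent M N → Equivalent N M := by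
  rintro ⟨e, he⟩
  refine ⟨e.symm, fun a => ?_⟩
  rw [LinearEquiv.symm_apply_eq, he, LinearEquiv.apply_symm_apply]

theorem Equivalent.trans {M N P : MarkedAlg k} : Equivalent M N → Equivalent N P →
    Equivalent M P := by
  rintro ⟨e, he⟩ ⟨f, hf⟩
  exact ⟨e.trans f, fun a => by simp [he, hf]⟩

theorem Equivalent.of_algEquiv {M N : MarkedAlg k} (e : M.A ≃ₐ[k] N.A) (h : e M.t = N.t) :
    Equivalent M N :=
  ⟨e.toLinearEquiv, fun a => by simp [h]⟩

instance setoid (k : Type) [Field k] : Setoid (MarkedAlg k) :=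
  ⟨Equivalent, Equivalent.refl, Equivalent.symm, Equivalent.trans⟩

/-- The number of cyclic summands of `A` as a `k[T]`-module, for nilpotent `t`. -/
noncomputable def blocks (M : MarkedAlg k) : ℕ :=
  Module.finrank k (M.A ⧸ Ideal.span {M.t})

/-- Rank–nullity. The kernel refers only to the action of T, which is all that `Equivalent`
preserves; an equivalence need not respect ideals. -/
theorem blocks_eq_finrank_ker (M : MarkedAlg k) :
    M.blocks = Module.finrank k (LinearMap.ker (LinearMap.mulLeft k M.t)) := by
  have h1 : LinearMap.range (LinearMap.mulLeft k M.t) =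
      (Ideal.span {M.t}).restrictScalars k := by
    ext x
    simp only [LinearMap.mem_range, LinearMap.mulLeft_apply, Submodule.restrictScalars_mem,
      Ideal.mem_span_singleton, dvd_def, eq_comm]
  have h2 := (Submodule.Quotient.restrictScalarsEquiv k (Ideal.span {M.t})).finrank_eq
  have h3 := LinearMap.finrank_range_add_finrank_ker (LinearMap.mulLeft k M.t)
  have h4 := Submodule.finrank_quotient_add_finrank ((Ideal.span {M.t}).restrictScalars k)
  rw [h1] at h3
  rw [blocks, ← h2]
  omega

theorem Equivalent.blocks_eq {M N : MarkedAlg k} : Equivalent M N → M.blocks = N.blocks := by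
  rintro ⟨e, he⟩
  rw [blocks_eq_finrank_ker, blocks_eq_finrank_ker]
  have : LinearMap.ker (LinearMap.mulLeft k M.t) =
      (LinearMap.ker (LinearMap.mulLeft k N.t)).comap (e : M.A →ₗ[k] N.A) := by
    ext x
    simp [← he]
  rw [this]
  exact (e.ofSubmodule' _).finrank_eq

/-- The tensor product over `k`, with `T` acting as `T ⊗ 1 + 1 ⊗ T`. -/
noncomputable def tensor (M N : MarkedAlg k) : MarkedAlg k where
  A := M.A ⊗[k] N.A
  t := M.t ⊗ₜ 1 + 1 ⊗ₜ N.t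

/-- The trivial one-dimensional module. -/
def unit (k : Type) [Field k] : MarkedAlg k where
  A := k
  t := 0

/-- The direct sum. -/
def pi {ι : Type} [Fintype ι] (M : ι → MarkedAlg k) : MarkedAlg k where
  A := ∀ i, (M i).A
  t := fun i => (M i).t

/-- The pullback along `T ↦ T ^ q`. -/
def frob (q : ℕ) (M : MarkedAlg k) : MarkedAlg k where
  A := M.A
  t := M.t ^ q

theorem Equivalent.tensor {M M' N N' : MarkedAlg k} : Equivalent M M' → Equivalent N N' →
    Equivalent (M.tensor N) (M'.tensor N') := by
  rintro ⟨e, he⟩ ⟨f, hf⟩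
  have key : ∀ a : M.A ⊗[k] N.A, TensorProduct.congr e f ((M.t ⊗ₜ 1 + 1 ⊗ₜ N.t) * a) =
      (M'.t ⊗ₜ 1 + 1 ⊗ₜ N'.t) * TensorProduct.congr e f a := by
    intro a
    induction a using TensorProduct.induction_on with
    | zero => simp
    | add x y hx hy => rw [mul_add, map_add, hx, hy, map_add, mul_add]
    | tmul x y => simp [add_mul, he, hf]
  exact ⟨TensorProduct.congr e f, key⟩

theorem tensor_comm (M N : MarkedAlg k) : Equivalent (M.tensor N) (N.tensor M) :=
  have key : Algebra.TensorProduct.comm k M.A N.A (M.t ⊗ₜ 1 + 1 ⊗ₜ N.t) =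
      N.t ⊗ₜ 1 + 1 ⊗ₜ M.t := by simp [add_comm]
  Equivalent.of_algEquiv (M := M.tensor N) (N := N.tensor M)
    (Algebra.TensorProduct.comm k M.A N.A) key

theorem tensor_assoc (M N P : MarkedAlg k) :
    Equivalent ((M.tensor N).tensor P) (M.tensor (N.tensor P)) :=
  have key : Algebra.TensorProduct.assoc k k k M.A N.A P.A
      ((M.t ⊗ₜ 1 + 1 ⊗ₜ N.t) ⊗ₜ 1 + 1 ⊗ₜ P.t) =
      M.t ⊗ₜ 1 + 1 ⊗ₜ (N.t ⊗ₜ 1 + 1 ⊗ₜ P.t) := by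
    simp [TensorProduct.add_tmul, TensorProduct.tmul_add,
        Algebra.TensorProduct.one_def, add_assoc]
  Equivalent.of_algEquiv (M := (M.tensor N).tensor P) (N := M.tensor (N.tensor P))
    (Algebra.TensorProduct.assoc k k k M.A N.A P.A) key

theorem unit_tensor (M : MarkedAlg k) : Equivalent ((unit k).tensor M) M :=
  have key : Algebra.TensorProduct.lid k M.A ((0 : k) ⊗ₜ 1 + 1 ⊗ₜ M.t) = M.t := by simp
  Equivalent.of_algEquiv (M := (unit k).tensor M) (N := M)
    (Algebra.TensorProduct.lid k M.A) key

theorem blocks_pi {ι : Type} [Fintype ι] (M : ι → MarkedAlg k) :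
    (pi M).blocks = ∑ i, (M i).blocks := by
  simp only [blocks_eq_finrank_ker]
  rw [← Module.finrank_pi_fintype k]
  refine LinearEquiv.finrank_eq
    { toFun := fun x i => ⟨x.1 i, congrFun x.2 i⟩
      invFun := fun x => ⟨fun i => (x i).1, funext fun i => (x i).2⟩
      map_add' := fun _ _ => rfl
      map_smul' := fun _ _ => rfl
      left_inv := fun _ => rfl
      right_inv := fun _ => rfl }

theorem tensor_pi {ι : Type} [Fintype ι] [DecidableEq ι] (M : MarkedAlg k) (N : ι → MarkedAlg k) :
    Equivalent (M.tensor (pi N)) (pi fun i => M.tensor (N i)) := by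
  have key : ∀ a : M.A ⊗[k] (∀ i, (N i).A), TensorProduct.piRight k k M.A (fun i => (N i).A)
      ((M.t ⊗ₜ 1 + 1 ⊗ₜ fun i => (N i).t) * a) =
      (fun i => M.t ⊗ₜ 1 + 1 ⊗ₜ (N i).t) *
        TensorProduct.piRight k k M.A (fun i => (N i).A) a := by
    intro a
    induction a using TensorProduct.induction_on with
    | zero => simp
    | add x y hx hy => rw [mul_add, map_add, hx, hy, map_add, mul_add]
    | tmul x y =>
      ext i
      simp [add_mul]
  exact ⟨TensorProduct.piRight k k M.A fun i => (N i).A, key⟩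

theorem Equivalent.frob {M N : MarkedAlg k} (q : ℕ) : Equivalent M N →
    Equivalent (M.frob q) (N.frob q) := by
  rintro ⟨e, he⟩
  have key : ∀ a, e (M.t ^ q * a) = N.t ^ q * e a := by
    induction q with
    | zero => simp
    | succ q ih => intro a; rw [pow_succ, mul_assoc, ih, he, pow_succ, mul_assoc]
  exact ⟨e, key⟩

/-- In characteristic p the q-th power of T⊗1 + 1⊗T is T^q⊗1 + 1⊗T^q, so Frobenius pullback is
multiplicative. -/
theorem frob_tensor {p : ℕ} [Fact p.Prime] [CharP k p] (e : ℕ) (M N : MarkedAlg k) :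
    (M.tensor N).frob (p ^ e) = (M.frob (p ^ e)).tensor (N.frob (p ^ e)) := by
  have key : (M.t ⊗ₜ 1 + 1 ⊗ₜ N.t : M.A ⊗[k] N.A) ^ p ^ e =
      (M.t ^ p ^ e) ⊗ₜ 1 + 1 ⊗ₜ (N.t ^ p ^ e) := by
    cases subsingleton_or_nontrivial (M.A ⊗[k] N.A) with
    | inl h => exact Subsingleton.elim _ _
    | inr h =>
      have : CharP (M.A ⊗[k] N.A) p :=
        charP_of_injective_algebraMap (algebraMap k _).injective p
      rw [add_pow_char_pow]
      simp [Algebra.TensorProduct.tmul_pow]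
  simp only [MarkedAlg.frob, MarkedAlg.tensor]
  congr 1

end MarkedAlg
end HilbertKunz
-- Cyclic modules
namespace HilbertKunz
open scoped TensorProduct

/-- The truncated polynomial ring `k[X] / (X ^ n)`. -/
abbrev TruncPoly (k : Type) [Field k] (n : ℕ) : Type := AdjoinRoot ((X : k[X]) ^ n)

section TruncPoly

variable (k : Type) [Field k] (n : ℕ)

/-- The class of the variable in `k[X] / (X ^ n)`. -/
noncomputable def TruncPoly.x : TruncPoly k n := AdjoinRoot.root _

theorem TruncPoly.x_pow : TruncPoly.x k n ^ n = 0 := by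
  rw [TruncPoly.x, ← AdjoinRoot.mk_X, ← map_pow, AdjoinRoot.mk_self]

theorem TruncPoly.x_pow_of_le {j : ℕ} (h : n ≤ j) : TruncPoly.x k n ^ j = 0 :=
  pow_eq_zero_of_le h (TruncPoly.x_pow k n)

theorem TruncPoly.mk_eq_aeval (f : k[X]) :
    AdjoinRoot.mk ((X : k[X]) ^ n) f = aeval (TruncPoly.x k n) f :=
  (AdjoinRoot.aeval_eq f).symm

instance TruncPoly.finite : Module.Finite k (TruncPoly k n) :=
  (monic_X_pow n).finite_adjoinRoot

theorem TruncPoly.finrank : Module.finrank k (TruncPoly k n) = n := by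
  rw [(AdjoinRoot.powerBasis' (monic_X_pow n)).finrank, AdjoinRoot.powerBasis'_dim,
    natDegree_X_pow]

end TruncPoly

namespace MarkedAlg

variable {k : Type} [Field k]

/-- The cyclic module `k[T] / (T ^ n)`. -/
noncomputable def cyc (k : Type) [Field k] (n : ℕ) : MarkedAlg k where
  A := TruncPoly k n
  t := TruncPoly.x k n

/-- Killing T⊗1 + 1⊗x identifies x with -T, and the relation x^c = 0 becomes T^c = 0. -/
theorem blocks_tensor_cyc (M : MarkedAlg k) (c : ℕ) :
    (M.tensor (cyc k c)).blocks = Module.finrank k (M.A ⧸ Ideal.span {M.t ^ c}) := by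
  set z : M.A ⊗[k] TruncPoly k c := M.t ⊗ₜ 1 + 1 ⊗ₜ TruncPoly.x k c with hz
  change Module.finrank k ((M.A ⊗[k] TruncPoly k c) ⧸ Ideal.span {z}) = _
  let I : Ideal M.A := Ideal.span {M.t ^ c}
  have hx : eval₂ (algebraMap k (M.A ⧸ I)) (-(Ideal.Quotient.mk I M.t)) (X ^ c) = 0 := by
    rw [eval₂_X_pow, neg_pow, ← map_pow,
      Ideal.Quotient.eq_zero_iff_mem.mpr (Ideal.mem_span_singleton_self _), mul_zero]
  let ev : TruncPoly k c →ₐ[k] M.A ⧸ I :=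
    AdjoinRoot.liftAlgHom _ (Algebra.ofId k _) (-(Ideal.Quotient.mk I M.t)) hx
  have hev : ev (TruncPoly.x k c) = -(Ideal.Quotient.mk I M.t) :=
    AdjoinRoot.liftAlgHom_root _ _ _ _
  let φ : M.A ⊗[k] TruncPoly k c →ₐ[k] M.A ⧸ I :=
    Algebra.TensorProduct.lift (Ideal.Quotient.mkₐ k I) ev fun _ _ => Commute.all _ _
  have hφs : Function.Surjective φ := by
    intro a
    obtain ⟨a, rfl⟩ := Ideal.Quotient.mk_surjective a
    exact ⟨a ⊗ₜ 1, by simp [φ]⟩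
  have hφz : φ z = 0 := by
    simp [φ, hz, hev]
  -- Modulo z each factor x on the right can be traded for -T on the left.
  have red : ∀ w : M.A ⊗[k] TruncPoly k c, ∃ a : M.A, ∃ b, w = a ⊗ₜ 1 + z * b := by
    intro w
    induction w using TensorProduct.induction_on with
    | zero => exact ⟨0, 0, by simp⟩
    | add u v hu hv =>
      obtain ⟨a, b, rfl⟩ := hu
      obtain ⟨a', b', rfl⟩ := hv
      exact ⟨a + a', b + b', by rw [TensorProduct.add_tmul]; ring⟩
    | tmul u v =>
      obtain ⟨f, rfl⟩ := AdjoinRoot.mk_surjective v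
      rw [TruncPoly.mk_eq_aeval]
      induction f using Polynomial.induction_on' with
      | add f g hf hg =>
        obtain ⟨a, b, h⟩ := hf
        obtain ⟨a', b', h'⟩ := hg
        exact ⟨a + a', b + b', by
          rw [map_add, TensorProduct.tmul_add, h, h', TensorProduct.add_tmul]; ring⟩
      | monomial j r =>
        have : ∃ a : M.A, ∃ b, u ⊗ₜ[k] (TruncPoly.x k c ^ j) = a ⊗ₜ 1 + z * b := by
          induction j with
          | zero => exact ⟨u, 0, by simp⟩
          | succ j ih =>
            obtain ⟨a, b, h⟩ := ih
            refine ⟨-(M.t * a), (1 ⊗ₜ TruncPoly.x k c) * b + a ⊗ₜ 1, ?_⟩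
            have h1 : u ⊗ₜ[k] (TruncPoly.x k c ^ (j + 1)) =
                (1 ⊗ₜ TruncPoly.x k c) * (u ⊗ₜ[k] (TruncPoly.x k c ^ j)) := by
              simp [pow_succ']
            have h2 : ((-(M.t * a)) ⊗ₜ[k] (1 : TruncPoly k c)) =
                -((M.t ⊗ₜ 1) * (a ⊗ₜ 1)) := by
              simp [TensorProduct.neg_tmul]
            rw [h1, h, h2, hz]
            ring
        obtain ⟨a, b, h⟩ := this
        refine ⟨r • a, r • b, ?_⟩
        rw [aeval_monomial, ← Algebra.smul_def, TensorProduct.tmul_smul, h, smul_add,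
          mul_smul_comm, TensorProduct.smul_tmul']
  have hker : RingHom.ker φ = Ideal.span {z} := by
    apply le_antisymm
    · intro w hw
      obtain ⟨a, b, rfl⟩ := red w
      rw [RingHom.mem_ker, map_add, map_mul, hφz, zero_mul, add_zero] at hw
      have ha : Ideal.Quotient.mk I a = 0 := by simpa [φ] using hw
      rw [Ideal.Quotient.eq_zero_iff_mem, Ideal.mem_span_singleton] at ha
      obtain ⟨a', rfl⟩ := ha
      refine Ideal.add_mem _ ?_ (Ideal.mul_mem_right _ _ (Ideal.mem_span_singleton_self _))
      have h3 : (Ideal.Quotient.mk (Ideal.span {z}) (M.t ⊗ₜ 1)) =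
          Ideal.Quotient.mk (Ideal.span {z}) (-(1 ⊗ₜ TruncPoly.x k c)) := by
        rw [Ideal.Quotient.eq, sub_neg_eq_add]
        exact Ideal.mem_span_singleton_self _
      have h4 : (M.t ^ c * a') ⊗ₜ[k] (1 : TruncPoly k c) = (M.t ⊗ₜ 1) ^ c * (a' ⊗ₜ 1) := by
        simp [Algebra.TensorProduct.tmul_pow]
      have h5 : ((1 : M.A) ⊗ₜ[k] TruncPoly.x k c) ^ c = 0 := by
        simp [Algebra.TensorProduct.tmul_pow, TruncPoly.x_pow]
      rw [← Ideal.Quotient.eq_zero_iff_mem, h4, map_mul, map_pow, h3, ← map_pow, neg_pow, h5,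
        mul_zero, map_zero, zero_mul]
    · rw [Ideal.span_singleton_le_iff_mem]
      exact hφz
  have e1 := (Ideal.quotientKerAlgEquivOfSurjective hφs).toLinearEquiv.finrank_eq
  rw [← e1]
  exact (Ideal.quotientEquivAlgOfEq k hker.symm).toLinearEquiv.finrank_eq

/-- The g i span B modulo T, so by Nakayama (T is nilpotent) the cyclic modules map onto B; equality
of dimensions then forces injectivity. Only an upper bound on the order of each generator has to be
checked. -/
theorem equivalent_pi_cyc (B : MarkedAlg k) {ι : Type} [Fintype ι] (g : ι → B.A) (n : ι → ℕ)
    (hn : ∀ i, B.t ^ n i * g i = 0)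
    (hs : ∀ a, ∃ c : ι → k, ∃ b, a = ∑ i, c i • g i + B.t * b)
    (ht : IsNilpotent B.t) (hdim : ∑ i, n i = Module.finrank k B.A) :
    Equivalent (pi fun i => cyc k (n i)) B := by
  classical
  let ψ : ∀ i, TruncPoly k (n i) →ₗ[k] B.A := fun i =>
    ((LinearMap.mulRight k (g i)).comp (aeval (R := k) B.t).toLinearMap).comp
      (AdjoinRoot.modByMonicHom (monic_X_pow (n i)))
  have hψ : ∀ i f, ψ i (AdjoinRoot.mk _ f) = aeval B.t f * g i := by
    intro i f
    simp only [ψ, LinearMap.comp_apply, AdjoinRoot.modByMonicHom_mk, AlgHom.toLinearMap_apply,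
      LinearMap.mulRight_apply]
    conv_rhs => rw [← modByMonic_add_div f (X ^ n i)]
    rw [map_add, map_mul, map_pow, aeval_X, add_mul, mul_right_comm, hn, zero_mul, add_zero]
  have hψt : ∀ i a, ψ i (TruncPoly.x k (n i) * a) = B.t * ψ i a := by
    intro i a
    obtain ⟨f, rfl⟩ := AdjoinRoot.mk_surjective a
    rw [TruncPoly.x, ← AdjoinRoot.mk_X, ← map_mul, hψ, hψ, map_mul, aeval_X, mul_assoc]
  let Ψ : (∀ i, TruncPoly k (n i)) →ₗ[k] B.A := ∑ i, (ψ i).comp (LinearMap.proj i)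
  have hΨ : ∀ a, Ψ a = ∑ i, ψ i (a i) := fun a => by simp [Ψ]
  have hΨt : ∀ a, Ψ ((fun i => TruncPoly.x k (n i)) * a) = B.t * Ψ a := by
    intro a
    simp only [hΨ, Pi.mul_apply, hψt, Finset.mul_sum]
  have hg : ∀ i, g i ∈ LinearMap.range Ψ := by
    intro i
    refine ⟨Pi.single i 1, ?_⟩
    rw [hΨ, Finset.sum_eq_single i]
    · rw [Pi.single_eq_same, ← map_one (AdjoinRoot.mk _), hψ]
      simp
    · intro j _ hj
      rw [Pi.single_eq_of_ne hj, map_zero]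
    · simp
  have hmul : ∀ a ∈ LinearMap.range Ψ, B.t * a ∈ LinearMap.range Ψ := by
    rintro _ ⟨a, rfl⟩
    exact ⟨_, hΨt a⟩
  have hall : ∀ j, ∀ a, ∃ b, a - B.t ^ j * b ∈ LinearMap.range Ψ := by
    intro j
    induction j with
    | zero => exact fun a => ⟨a, by simp⟩
    | succ j ih =>
      intro a
      obtain ⟨b, hb⟩ := ih a
      obtain ⟨c, b', rfl⟩ := hs b
      refine ⟨b', ?_⟩
      have h1 : ∀ x ∈ LinearMap.range Ψ, B.t ^ j * x ∈ LinearMap.range Ψ := by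
        intro x hx
        clear hb ih
        induction j with
        | zero => simpa
        | succ j ih => rw [pow_succ', mul_assoc]; exact hmul _ ih
      have h2 : ∑ i, c i • g i ∈ LinearMap.range Ψ :=
        Submodule.sum_mem _ fun i _ => Submodule.smul_mem _ _ (hg i)
      have := Submodule.add_mem _ hb (h1 _ h2)
      convert this using 1
      ring
  have hsurj : Function.Surjective Ψ := by
    intro a
    obtain ⟨N, hN⟩ := ht
    obtain ⟨b, hb⟩ := hall N a
    rw [hN, zero_mul, sub_zero] at hb
    exact hb
  have hfr : Module.finrank k (∀ i, TruncPoly k (n i)) = Module.finrank k B.A := by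
    rw [Module.finrank_pi_fintype, ← hdim]
    simp only [TruncPoly.finrank]
  have hinj : Function.Injective Ψ :=
    (LinearMap.injective_iff_surjective_of_finrank_eq_finrank hfr).mpr hsurj
  exact ⟨LinearEquiv.ofBijective Ψ ⟨hinj, hsurj⟩, hΨt⟩

end MarkedAlg
end HilbertKunz
-- The representation ring
namespace HilbertKunz
open scoped TensorProduct

/-- Equivalence classes of marked algebras; a commutative monoid under the tensor product. -/
def IsoClass (k : Type) [Field k] : Type 1 := Quotient (MarkedAlg.setoid k)

namespace IsoClass

variable {k : Type} [Field k]

/-- The class of a marked algebra. -/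
def mk (M : MarkedAlg k) : IsoClass k := Quotient.mk _ M

theorem sound {M N : MarkedAlg k} (h : MarkedAlg.Equivalent M N) : mk M = mk N := Quotient.sound h

noncomputable instance : CommMonoid (IsoClass k) where
  mul := Quotient.map₂ MarkedAlg.tensor fun _ _ h _ _ h' => h.tensor h'
  one := mk (MarkedAlg.unit k)
  mul_assoc := by
    rintro ⟨M⟩ ⟨N⟩ ⟨P⟩
    exact sound (MarkedAlg.tensor_assoc M N P)
  mul_comm := by
    rintro ⟨M⟩ ⟨N⟩
    exact sound (MarkedAlg.tensor_comm M N)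
  one_mul := by
    rintro ⟨M⟩
    exact sound (MarkedAlg.unit_tensor M)
  mul_one := by
    rintro ⟨M⟩
    exact sound ((MarkedAlg.tensor_comm _ _).trans (MarkedAlg.unit_tensor M))

theorem mk_mul_mk (M N : MarkedAlg k) : mk M * mk N = mk (M.tensor N) := rfl

theorem ind {C : IsoClass k → Prop} (h : ∀ M, C (mk M)) (x : IsoClass k) : C x :=
  Quotient.ind h x

/-- The number of blocks of a class. -/
noncomputable def blocks : IsoClass k → ℕ :=
  Quotient.lift MarkedAlg.blocks fun _ _ h => MarkedAlg.Equivalent.blocks_eq h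

theorem blocks_mk (M : MarkedAlg k) : blocks (mk M) = M.blocks := rfl

/-- The pullback along `T ↦ T ^ q` on classes. -/
def frob (q : ℕ) : IsoClass k → IsoClass k :=
  Quotient.map (MarkedAlg.frob q) fun _ _ h => MarkedAlg.Equivalent.frob q h

theorem frob_mk (q : ℕ) (M : MarkedAlg k) : frob q (mk M) = mk (M.frob q) := rfl

theorem frob_mul {p : ℕ} [Fact p.Prime] [CharP k p] (e : ℕ) (x y : IsoClass k) :
    frob (p ^ e) (x * y) = frob (p ^ e) x * frob (p ^ e) y := by
  induction x using ind with | h M =>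
  induction y using ind with | h N =>
  rw [mk_mul_mk, frob_mk, MarkedAlg.frob_tensor, frob_mk, frob_mk, mk_mul_mk]

theorem frob_one {q : ℕ} (hq : q ≠ 0) : frob q (1 : IsoClass k) = 1 := by
  change mk ((MarkedAlg.unit k).frob q) = mk (MarkedAlg.unit k)
  congr 1
  simp only [MarkedAlg.frob, MarkedAlg.unit]
  congr 1
  exact zero_pow hq

theorem frob_pow {p : ℕ} [Fact p.Prime] [CharP k p] (e : ℕ) (x : IsoClass k) (n : ℕ) :
    frob (p ^ e) (x ^ n) = frob (p ^ e) x ^ n := by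
  induction n with
  | zero => rw [pow_zero, pow_zero, frob_one (pow_ne_zero _ (Fact.out : p.Prime).ne_zero)]
  | succ n ih => rw [pow_succ, frob_mul, ih, pow_succ]

end IsoClass

section GreenRing

variable (k : Type) [Field k]

/-- The linear extension of the number of blocks to formal combinations of classes. -/
noncomputable def formalBlocks : MonoidAlgebra ℚ (IsoClass k) →ₗ[ℚ] ℚ :=
  (Finsupp.linearCombination ℚ fun x : IsoClass k => (x.blocks : ℚ)).comp
    (MonoidAlgebra.coeffLinearEquiv ℚ).toLinearMap

theorem formalBlocks_of (x : IsoClass k) :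
    formalBlocks k (MonoidAlgebra.of ℚ _ x) = x.blocks := by
  simp [formalBlocks, MonoidAlgebra.of_apply]

/-- The combinations whose multiples all have no blocks. -/
noncomputable def blocksRadical : Ideal (MonoidAlgebra ℚ (IsoClass k)) where
  carrier := {x | ∀ y, formalBlocks k (x * y) = 0}
  zero_mem' := by simp
  add_mem' hx hy z := by rw [add_mul, map_add, hx, hy, add_zero]
  smul_mem' c x hx y := by rw [smul_eq_mul, mul_comm c, mul_assoc, hx]

/-- The representation ring of nilpotent `k[T]`-modules with primitive `T`, with rational
coefficients, modulo the radical of the form given by the number of blocks. -/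
abbrev GreenRing : Type 1 := MonoidAlgebra ℚ (IsoClass k) ⧸ blocksRadical k

variable {k}

/-- The class of a module in the representation ring. -/
noncomputable def cl : IsoClass k →* GreenRing k :=
  (Ideal.Quotient.mk (blocksRadical k)).toMonoidHom.comp (MonoidAlgebra.of ℚ (IsoClass k))

variable (k) in
/-- The number of blocks, as a linear functional on the representation ring. -/
noncomputable def alpha : GreenRing k →ₗ[ℚ] ℚ :=
  (Submodule.liftQ ((blocksRadical k).restrictScalars ℚ) (formalBlocks k) (by
      intro x hx
      have := hx 1
      rwa [mul_one] at this)).comp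
    (Submodule.Quotient.restrictScalarsEquiv ℚ (blocksRadical k)).symm.toLinearMap

theorem alpha_mk (x : MonoidAlgebra ℚ (IsoClass k)) :
    alpha k (Ideal.Quotient.mk _ x) = formalBlocks k x := rfl

theorem alpha_cl (x : IsoClass k) : alpha k (cl x) = x.blocks := by
  rw [← formalBlocks_of, ← alpha_mk]
  rfl

/-- The radical was divided out precisely so that equality can be tested by counting blocks against
modules. -/
theorem greenRing_ext {x y : GreenRing k}
    (h : ∀ M : MarkedAlg k, alpha k (x * cl (IsoClass.mk M)) = alpha k (y * cl (IsoClass.mk M))) :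
    x = y := by
  obtain ⟨x, rfl⟩ := Ideal.Quotient.mk_surjective x
  obtain ⟨y, rfl⟩ := Ideal.Quotient.mk_surjective y
  rw [Ideal.Quotient.eq]
  intro z
  rw [sub_mul, map_sub, sub_eq_zero]
  induction z using MonoidAlgebra.induction_on with
  | of g =>
    induction g using IsoClass.ind with | h M =>
    exact h M
  | add f g hf hg => rw [mul_add, map_add, hf, hg, mul_add, map_add]
  | smul r f hf => rw [mul_smul_comm, map_smul, hf, mul_smul_comm, map_smul]

variable (k) in
/-- The class of `k[T] / (T ^ n)`. -/
noncomputable def dl (n : ℕ) : GreenRing k := cl (IsoClass.mk (MarkedAlg.cyc k n))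

theorem alpha_dl_mul_cl_mk (n : ℕ) (M : MarkedAlg k) :
    alpha k (dl k n * cl (IsoClass.mk M)) = Module.finrank k (M.A ⧸ Ideal.span {M.t ^ n}) := by
  rw [dl, ← map_mul, alpha_cl, mul_comm, IsoClass.mk_mul_mk, IsoClass.blocks_mk,
    MarkedAlg.blocks_tensor_cyc]

/-- Both sides are the dimension of M/T^n M; multiplication by `dl k n` is traded for a pullback
under α. -/
theorem alpha_dl_mul_cl (n : ℕ) (x : IsoClass k) :
    alpha k (dl k n * cl x) = alpha k (cl (x.frob n)) := by
  induction x using IsoClass.ind with | h M =>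
  rw [alpha_dl_mul_cl_mk, alpha_cl]
  rfl

theorem dl_zero : dl k 0 = 0 := by
  refine greenRing_ext fun M => ?_
  rw [alpha_dl_mul_cl_mk, pow_zero, Ideal.span_singleton_one, zero_mul, map_zero, Nat.cast_eq_zero]
  exact Module.finrank_zero_of_subsingleton

theorem dl_one : dl k 1 = 1 := by
  refine greenRing_ext fun M => ?_
  rw [alpha_dl_mul_cl_mk, pow_one, one_mul, alpha_cl]
  rfl

theorem alpha_dl {n : ℕ} (hn : n ≠ 0) : alpha k (dl k n) = 1 := by
  have h := alpha_dl_mul_cl_mk n (MarkedAlg.unit k)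
  have h1 : cl (IsoClass.mk (MarkedAlg.unit k)) = 1 := map_one cl
  rw [h1, mul_one] at h
  rw [h]
  have h2 : (MarkedAlg.unit k).t ^ n = 0 := zero_pow hn
  have h3 : Module.finrank k ((MarkedAlg.unit k).A ⧸ Ideal.span {(MarkedAlg.unit k).t ^ n}) =
      Module.finrank k (MarkedAlg.unit k).A := by
    rw [h2, Ideal.span_singleton_zero]
    exact (AlgEquiv.quotientBot k (MarkedAlg.unit k).A).toLinearEquiv.finrank_eq
  rw [h3]
  exact_mod_cast Module.finrank_self k

theorem alpha_dl_mul_cl_of_pow_eq_zero (M : MarkedAlg k) {n c : ℕ} (hM : M.t ^ n = 0)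
    (hc : n ≤ c) :
    alpha k (dl k c * cl (IsoClass.mk M)) = alpha k (dl k n * cl (IsoClass.mk M)) := by
  rw [alpha_dl_mul_cl_mk, alpha_dl_mul_cl_mk, hM, pow_eq_zero_of_le hc hM]

/-- In the monoid algebra the class of a direct sum is not a sum of classes. It becomes one modulo
the radical, because tensor products distribute over direct sums and block numbers add. -/
theorem cl_eq_sum_dl (B : MarkedAlg k) {c : ℕ} (g : ℕ → B.A) (n : ℕ → ℕ)
    (hn : ∀ i < c, B.t ^ n i * g i = 0)
    (hs : ∀ a, a ∈ Submodule.span k (g '' Set.Iio c) ⊔ LinearMap.range (LinearMap.mulLeft k B.t))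
    (ht : IsNilpotent B.t) (hdim : ∑ i ∈ Finset.range c, n i = Module.finrank k B.A) :
    cl (IsoClass.mk B) = ∑ i ∈ Finset.range c, dl k (n i) := by
  have hE : MarkedAlg.Equivalent (MarkedAlg.pi fun i : Fin c => MarkedAlg.cyc k (n i)) B := by
    refine MarkedAlg.equivalent_pi_cyc B (fun i : Fin c => g i) (fun i => n i)
      (fun i => hn i i.2) (fun a => ?_) ht ?_
    · obtain ⟨y, hy, _, ⟨b, rfl⟩, rfl⟩ := Submodule.mem_sup.mp (hs a)
      have himg : g '' Set.Iio c = Set.range fun i : Fin c => g i := by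
        ext z
        simp only [Set.mem_image, Set.mem_Iio, Set.mem_range]
        exact ⟨fun ⟨i, hi, h⟩ => ⟨⟨i, hi⟩, h⟩, fun ⟨i, h⟩ => ⟨i, i.2, h⟩⟩
      rw [himg, Submodule.mem_span_range_iff_exists_fun] at hy
      obtain ⟨w, rfl⟩ := hy
      exact ⟨w, b, rfl⟩
    · rw [← hdim, Finset.sum_range]
  refine greenRing_ext fun M => ?_
  have h1 : ∀ n, alpha k (dl k n * cl (IsoClass.mk M)) = (M.tensor (MarkedAlg.cyc k n)).blocks := by
    intro n
    rw [alpha_dl_mul_cl_mk, MarkedAlg.blocks_tensor_cyc]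
  rw [Finset.sum_mul, map_sum]
  simp only [h1]
  rw [← IsoClass.sound hE, ← map_mul, mul_comm, IsoClass.mk_mul_mk, alpha_cl,
    IsoClass.sound (MarkedAlg.tensor_pi _ _), IsoClass.blocks_mk, MarkedAlg.blocks_pi,
    Nat.cast_sum, Finset.sum_range]

end GreenRing
end HilbertKunz
-- Product formulas for cyclic modules
namespace HilbertKunz
open scoped TensorProduct

section Pieri

variable {k : Type} [Field k]

theorem tensor_truncPoly_mem (c c' : ℕ)
    (N : Submodule k (TruncPoly k c ⊗[k] TruncPoly k c'))
    (hN : ∀ b, (TruncPoly.x k c ⊗ₜ[k] (1 : TruncPoly k c') + 1 ⊗ₜ TruncPoly.x k c') * b ∈ N)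
    (hS : ∀ i < c, (TruncPoly.x k c ⊗ₜ[k] (1 : TruncPoly k c')) ^ i ∈ N)
    (a : TruncPoly k c ⊗[k] TruncPoly k c') : a ∈ N := by
  set S := TruncPoly.x k c ⊗ₜ[k] (1 : TruncPoly k c') with hSdef
  set W := (1 : TruncPoly k c) ⊗ₜ[k] TruncPoly.x k c' with hWdef
  have hS' : ∀ i, S ^ i ∈ N := by
    intro i
    rcases lt_or_ge i c with h | h
    · exact hS i h
    · have : S ^ i = 0 := by
        rw [hSdef, Algebra.TensorProduct.tmul_pow, TruncPoly.x_pow_of_le k c h,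
          TensorProduct.zero_tmul]
      rw [this]
      exact N.zero_mem
  have hSW : ∀ l i, S ^ i * W ^ l ∈ N := by
    intro l
    induction l with
    | zero => simpa using hS'
    | succ l ih =>
      intro i
      have : S ^ i * W ^ (l + 1) = (S + W) * (S ^ i * W ^ l) - S ^ (i + 1) * W ^ l := by ring
      rw [this]
      exact N.sub_mem (hN _) (ih _)
  induction a using TensorProduct.induction_on with
  | zero => exact N.zero_mem
  | add x y hx hy => exact N.add_mem hx hy
  | tmul u v =>
    obtain ⟨f, rfl⟩ := AdjoinRoot.mk_surjective u
    obtain ⟨g, rfl⟩ := AdjoinRoot.mk_surjective v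
    rw [TruncPoly.mk_eq_aeval, TruncPoly.mk_eq_aeval]
    induction f using Polynomial.induction_on' with
    | add f f' hf hf' => rw [map_add, TensorProduct.add_tmul]; exact N.add_mem hf hf'
    | monomial i r =>
      induction g using Polynomial.induction_on' with
      | add f f' hf hf' => rw [map_add, TensorProduct.tmul_add]; exact N.add_mem hf hf'
      | monomial l s =>
        rw [aeval_monomial, aeval_monomial, ← Algebra.smul_def, ← Algebra.smul_def,
          TensorProduct.tmul_smul, ← TensorProduct.smul_tmul']
        refine N.smul_mem _ (N.smul_mem _ ?_)
        have := hSW l i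
        rwa [hSdef, hWdef, Algebra.TensorProduct.tmul_pow, Algebra.TensorProduct.tmul_pow,
          Algebra.TensorProduct.tmul_mul_tmul, one_pow, one_pow, one_mul, mul_one] at this

/-- Modulo S + W the tensor product is spanned by the S^i with i < c, so elements congruent to
nonzero multiples of these generate it over k[T]. -/
theorem dl_mul_dl (c c' : ℕ) (g : ℕ → TruncPoly k c ⊗[k] TruncPoly k c') (n : ℕ → ℕ)
    (hn : ∀ i < c,
      (TruncPoly.x k c ⊗ₜ[k] (1 : TruncPoly k c') + 1 ⊗ₜ TruncPoly.x k c') ^ n i * g i = 0)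
    (hg : ∀ i < c, ∃ u : k, u ≠ 0 ∧
      (TruncPoly.x k c ⊗ₜ[k] (1 : TruncPoly k c') + 1 ⊗ₜ TruncPoly.x k c') ∣
        g i - algebraMap k _ u * (TruncPoly.x k c ⊗ₜ[k] (1 : TruncPoly k c')) ^ i)
    (hdim : ∑ i ∈ Finset.range c, n i = c * c') :
    dl k c * dl k c' = ∑ i ∈ Finset.range c, dl k (n i) := by
  set S := TruncPoly.x k c ⊗ₜ[k] (1 : TruncPoly k c') with hSdef
  set W := (1 : TruncPoly k c) ⊗ₜ[k] TruncPoly.x k c' with hWdef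
  have hnil : IsNilpotent (S + W) := by
    refine (Commute.all S W).isNilpotent_add ⟨c, ?_⟩ ⟨c', ?_⟩
    · rw [hSdef, Algebra.TensorProduct.tmul_pow, TruncPoly.x_pow, TensorProduct.zero_tmul]
    · rw [hWdef, Algebra.TensorProduct.tmul_pow, TruncPoly.x_pow, TensorProduct.tmul_zero]
  have hspan : ∀ a, a ∈ Submodule.span k (g '' Set.Iio c) ⊔
      LinearMap.range (LinearMap.mulLeft k (S + W)) := by
    have h1 : ∀ b, (S + W) * b ∈ Submodule.span k (g '' Set.Iio c) ⊔
        LinearMap.range (LinearMap.mulLeft k (S + W)) :=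
      fun b => Submodule.mem_sup_right ⟨b, rfl⟩
    refine tensor_truncPoly_mem c c' _ h1 fun i hi => ?_
    obtain ⟨u, hu, b, hb⟩ := hg i hi
    have h2 : S ^ i = u⁻¹ • (g i - (S + W) * b) := by
      rw [← hb, sub_sub_cancel, ← Algebra.smul_def, inv_smul_smul₀ hu]
    rw [← hSdef, h2]
    exact Submodule.smul_mem _ _ (Submodule.sub_mem _
      (Submodule.mem_sup_left (Submodule.subset_span ⟨i, hi, rfl⟩)) (h1 b))
  have hfr : ∑ i ∈ Finset.range c, n i =
      Module.finrank k (TruncPoly k c ⊗[k] TruncPoly k c') := by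
    rw [Module.finrank_tensorProduct, TruncPoly.finrank, TruncPoly.finrank, hdim]
  rw [dl, dl, ← map_mul, IsoClass.mk_mul_mk]
  exact cl_eq_sum_dl ((MarkedAlg.cyc k c).tensor (MarkedAlg.cyc k c')) g n hn hspan hnil hfr

/-- The generators are 1, x, ..., x^(r-1). -/
theorem cl_frob_cyc (r N : ℕ) (hr : r ≠ 0) (n : ℕ → ℕ) (hn : ∀ i < r, N ≤ r * n i + i)
    (hdim : ∑ i ∈ Finset.range r, n i = N) :
    cl (IsoClass.mk ((MarkedAlg.cyc k N).frob r)) = ∑ i ∈ Finset.range r, dl k (n i) := by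
  have h1 : ∀ i < r, (TruncPoly.x k N ^ r) ^ n i * TruncPoly.x k N ^ i = 0 := by
    intro i hi
    rw [← pow_mul, ← pow_add]
    exact TruncPoly.x_pow_of_le k N (hn i hi)
  have h2 : ∀ a, a ∈ Submodule.span k ((fun i => TruncPoly.x k N ^ i) '' Set.Iio r) ⊔
      LinearMap.range (LinearMap.mulLeft k (TruncPoly.x k N ^ r)) := by
    intro a
    obtain ⟨f, rfl⟩ := AdjoinRoot.mk_surjective a
    rw [TruncPoly.mk_eq_aeval]
    induction f using Polynomial.induction_on' with
    | add f f' hf hf' => rw [map_add]; exact Submodule.add_mem _ hf hf'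
    | monomial i s =>
      rw [aeval_monomial, ← Algebra.smul_def]
      refine Submodule.smul_mem _ _ ?_
      rcases lt_or_ge i r with h | h
      · exact Submodule.mem_sup_left (Submodule.subset_span ⟨i, h, rfl⟩)
      · refine Submodule.mem_sup_right ⟨TruncPoly.x k N ^ (i - r), ?_⟩
        rw [LinearMap.mulLeft_apply, ← pow_add, Nat.add_sub_cancel' h]
  have h3 : IsNilpotent (TruncPoly.x k N ^ r) :=
    ⟨N, by rw [pow_right_comm, TruncPoly.x_pow, zero_pow hr]⟩
  have h4 : ∑ i ∈ Finset.range r, n i = Module.finrank k (TruncPoly k N) := by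
    rw [hdim, TruncPoly.finrank]
  exact cl_eq_sum_dl ((MarkedAlg.cyc k N).frob r) _ n h1 h2 h3 h4

theorem add_dvd_pow_sub {R : Type*} [CommRing R] [Algebra k R] (S W : R) (b : ℕ) :
    S + W ∣ W ^ b - algebraMap k R ((-1) ^ b) * S ^ b := by
  have h := sub_dvd_pow_sub_pow W (-S) b
  rw [sub_neg_eq_add, add_comm W S, neg_pow S b] at h
  simpa using h

variable (k) (p : ℕ) [Fact p.Prime] [CharP k p]

/-- Reduces a product formula to identities in any commutative k-algebra with two nilpotent
elements. Additivity of Frobenius is supplied as a hypothesis so that the zero ring, which is not of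
characteristic p, is also covered. -/
theorem dl_mul_dl_of_ring (c c' : ℕ) (n : ℕ → ℕ)
    (h : ∀ (R : Type) [CommRing R] [Algebra k R] (S W : R), S ^ c = 0 → W ^ c' = 0 →
      (∀ e, (S + W) ^ p ^ e = S ^ p ^ e + W ^ p ^ e) →
      ∃ g : ℕ → R, ∀ i < c, (S + W) ^ n i * g i = 0 ∧
        ∃ u : k, u ≠ 0 ∧ S + W ∣ g i - algebraMap k R u * S ^ i)
    (hdim : ∑ i ∈ Finset.range c, n i = c * c') :
    dl k c * dl k c' = ∑ i ∈ Finset.range c, dl k (n i) := by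
  obtain ⟨g, hg⟩ := h (TruncPoly k c ⊗[k] TruncPoly k c') (TruncPoly.x k c ⊗ₜ 1)
    (1 ⊗ₜ TruncPoly.x k c')
    (by rw [Algebra.TensorProduct.tmul_pow, TruncPoly.x_pow, TensorProduct.zero_tmul])
    (by rw [Algebra.TensorProduct.tmul_pow, TruncPoly.x_pow, TensorProduct.tmul_zero])
    (by
      intro e
      cases subsingleton_or_nontrivial (TruncPoly k c ⊗[k] TruncPoly k c') with
      | inl h => exact Subsingleton.elim _ _
      | inr h =>
        have : CharP (TruncPoly k c ⊗[k] TruncPoly k c') p :=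
          charP_of_injective_algebraMap (algebraMap k _).injective p
        rw [add_pow_char_pow])
  exact dl_mul_dl c c' g n (fun i hi => (hg i hi).1) (fun i hi => (hg i hi).2) hdim

/-- Here (S + W)^(qa) = (S^q + W^q)^a = W^(qa) = 0, so T^(qa) kills the whole module. -/
theorem dl_mul_dl_mul (e a : ℕ) :
    dl k (p ^ e) * dl k (p ^ e * a) = p ^ e • dl k (p ^ e * a) := by
  rw [dl_mul_dl_of_ring k p (p ^ e) (p ^ e * a) (fun _ => p ^ e * a), Finset.sum_const,
    Finset.card_range]
  · intro R _ _ S W hS hW hZ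
    refine ⟨fun i => S ^ i, fun i _ => ⟨?_, 1, one_ne_zero, by simp⟩⟩
    rw [pow_mul, hZ, hS, zero_add, ← pow_mul, hW, zero_mul]
  · rw [Finset.sum_const, Finset.card_range, smul_eq_mul]

/-- Since S^q = 0, T^q acts as W^q, which kills every multiple of W; and S^b = 0 makes T^b itself a
multiple of W. -/
theorem dl_mul_dl_succ (e b : ℕ) (hb : 0 < b) (hbq : b < p ^ e) :
    dl k b * dl k (p ^ e + 1) = dl k (p ^ e + b) + (b - 1) • dl k (p ^ e) := by
  obtain ⟨b, rfl⟩ := Nat.exists_eq_add_of_lt hb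
  rw [zero_add] at *
  set q := p ^ e with hq
  rw [dl_mul_dl_of_ring k p (b + 1) (q + 1) (fun i => if i = 0 then q + (b + 1) else q)]
  · rw [Finset.sum_range_succ']
    simp [add_comm]
  · intro R _ _ S W hS hW hZ
    have hZ' := hZ e
    rw [← hq, pow_eq_zero_of_le hbq.le hS, zero_add] at hZ'
    refine ⟨fun i => if i = 0 then 1 else S ^ (i - 1) * W, fun i hi => ?_⟩
    rcases i with - | i
    · refine ⟨?_, 1, one_ne_zero, by simp⟩
      simp only [if_true, mul_one]
      rw [pow_add, hZ']
      have h1 : W ∣ (S + W) ^ (b + 1) := by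
        have h2 := sub_dvd_pow_sub_pow (S + W) S (b + 1)
        rwa [hS, sub_zero, add_sub_cancel_left] at h2
      obtain ⟨y, hy⟩ := h1
      rw [hy, ← mul_assoc, ← pow_succ, hW, zero_mul]
    · simp only [Nat.add_one_ne_zero, if_false, Nat.add_sub_cancel]
      refine ⟨?_, -1, by simp, S ^ i, by rw [map_neg, map_one]; ring⟩
      rw [hZ', mul_left_comm, ← pow_succ, hW, mul_zero]
  · rw [Finset.sum_range_succ']
    simp
    ring

/-- The Clebsch–Gordan rule, valid as long as a is invertible in k. -/
theorem dl_two_mul_dl (a : ℕ) (ha : 0 < a) (hap : a < p) :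
    dl k 2 * dl k a = dl k (a + 1) + dl k (a - 1) := by
  obtain ⟨a, rfl⟩ := Nat.exists_eq_add_of_lt ha
  rw [zero_add] at *
  have hak : ((a + 1 : ℕ) : k) ≠ 0 := by
    rw [Ne, CharP.cast_eq_zero_iff k p]
    exact Nat.not_dvd_of_pos_of_lt ha hap
  rw [dl_mul_dl_of_ring k p 2 (a + 1) (fun i => if i = 0 then a + 2 else a)]
  · simp [Finset.sum_range_succ]
  · intro R _ _ S W hS hW _
    have hpow : ∀ n : ℕ, (S + W) ^ (n + 1) = W ^ (n + 1) + (n + 1) * S * W ^ n := by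
      intro n
      induction n with
      | zero => simp [add_comm]
      | succ n ih =>
        rw [pow_succ, ih]
        push_cast
        linear_combination ((n : R) + 1) * W ^ n * hS
    -- With S² = 0, T^a = W^a + a·S·W^(a-1), and the S-term of the second generator cancels the
    -- resulting S·W^a. Modulo S + W this generator is -(a+1)·S.
    refine ⟨fun i => if i = 0 then 1 else W - (a : R) * S, fun i hi => ?_⟩
    interval_cases i
    · refine ⟨?_, 1, one_ne_zero, by simp⟩
      simp only [if_true, mul_one]
      rw [hpow]
      push_cast
      linear_combination (W + (a + 2) * S) * hW
    · simp only [one_ne_zero, if_false]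
      refine ⟨?_, -((a + 1 : ℕ) : k), neg_ne_zero.mpr hak, 1, ?_⟩
      · rcases a with - | a
        · simpa using hW
        · rw [hpow]
          push_cast
          linear_combination hW - (a + 1 : R) * (a + 1) * W ^ a * hS
      · simp only [map_neg, map_natCast]
        push_cast
        ring
  · simp [Finset.sum_range_succ]
    ring

theorem sum_range_of_five_values {M : Type*} [AddCommMonoid M] (F : ℕ → M) (b q : ℕ)
    (hb : 0 < b) (hbq : b < q) (v₀ v₁ v₂ v₃ v₄ : ℕ) :
    ∑ j ∈ Finset.range (q + 1), F (if j = 0 then v₀ else if j < b then v₁ else if j = b then v₂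
      else if j < q then v₃ else v₄) =
    F v₀ + (b - 1) • F v₁ + F v₂ + (q - b - 1) • F v₃ + F v₄ := by
  obtain ⟨b, rfl⟩ := Nat.exists_eq_add_of_lt hb
  obtain ⟨r, rfl⟩ := Nat.exists_eq_add_of_lt hbq
  rw [zero_add, Finset.sum_range_succ, show b + 1 + r + 1 = b + 1 + (r + 1) by ring,
    Finset.sum_range_add, Finset.sum_range_succ', Finset.sum_range_succ']
  have h1 : ∀ j ∈ Finset.range b, F (if j + 1 = 0 then v₀ else if j + 1 < b + 1 then v₁
      else if j + 1 = b + 1 then v₂ else if j + 1 < b + 1 + (r + 1) then v₃ else v₄) = F v₁ := by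
    intro j hj
    have := Finset.mem_range.mp hj
    rw [if_neg (by omega), if_pos (by omega)]
  have h2 : ∀ j ∈ Finset.range r, F (if b + 1 + (j + 1) = 0 then v₀
      else if b + 1 + (j + 1) < b + 1 then v₁
      else if b + 1 + (j + 1) = b + 1 then v₂
      else if b + 1 + (j + 1) < b + 1 + (r + 1) then v₃ else v₄) = F v₃ := by
    intro j hj
    have := Finset.mem_range.mp hj
    rw [if_neg (by omega), if_neg (by omega), if_neg (by omega), if_pos (by omega)]
  rw [Finset.sum_congr rfl h1, Finset.sum_congr rfl h2, Finset.sum_const, Finset.sum_const,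
    Finset.card_range, Finset.card_range, show b + 1 + (r + 1) - (b + 1) - 1 = r by omega, if_pos rfl,
    if_neg (by omega : ¬ b + 1 + 0 = 0), if_neg (by omega : ¬ b + 1 + 0 < b + 1),
    if_pos (by omega : b + 1 + 0 = b + 1), if_neg (by omega : ¬ b + 1 + (r + 1) = 0),
    if_neg (by omega : ¬ b + 1 + (r + 1) < b + 1), if_neg (by omega : ¬ b + 1 + (r + 1) = b + 1),
    if_neg (lt_irrefl _), Nat.add_sub_cancel]
  abel

/-- Powers of `S + W` when `(S + W) ^ q = S ^ q + W ^ q` and `S ^ (q + 1) = 0`. -/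
theorem pow_mul_of_pow_succ_eq_zero {R : Type*} [CommRing R] {S W : R} {q : ℕ} (hq : 0 < q)
    (hS : S ^ (q + 1) = 0) (hZ : (S + W) ^ q = S ^ q + W ^ q) (n : ℕ) :
    (S + W) ^ (q * (n + 1)) = W ^ (q * (n + 1)) + (n + 1) * S ^ q * W ^ (q * n) := by
  have h0 : S ^ q * S ^ q = 0 := by rw [← pow_add]; exact pow_eq_zero_of_le (by omega) hS
  induction n with
  | zero => simp [hZ, add_comm]
  | succ n ih =>
    rw [Nat.mul_succ, pow_add, ih, hZ, pow_add, Nat.mul_succ q n, pow_add]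
    push_cast
    linear_combination ((n : R) + 1) * W ^ (q * n) * h0

/-- On multiples of S^q the element S acts as zero, so S + W acts as W. -/
theorem pow_mul_add_pow {R : Type*} [CommRing R] {S W : R} {q : ℕ}
    (hS : S ^ (q + 1) = 0) (n : ℕ) : S ^ q * (S + W) ^ n = S ^ q * W ^ n := by
  have h := sub_dvd_pow_sub_pow (S + W) W n
  rw [add_sub_cancel_right] at h
  obtain ⟨y, hy⟩ := h
  rw [← sub_eq_zero, ← mul_sub, hy, ← mul_assoc, ← pow_succ, hS, zero_mul]

/-- The values common to all cases of the product of `dl (q + 1)` and `dl (q * a + b)`, for the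
generators of degree greater than `b`. -/
theorem exists_generator_of_lt {R : Type} [CommRing R] [Algebra k R] {S W : R} {q a b j : ℕ}
    (hb : 0 < b) (hbj : b < j) (hjq : j ≤ q) (hak : ((a + 1 : ℕ) : k) ≠ 0)
    (hS : S ^ (q + 1) = 0) (hW : W ^ (q * (a + 1) + b) = 0)
    (hZ : (S + W) ^ q = S ^ q + W ^ q) :
    ∃ g : R, (S + W) ^ (if j < q then q * (a + 1) else q * a + b) * g = 0 ∧
        ∃ u : k, u ≠ 0 ∧ S + W ∣ g - algebraMap k R u * S ^ j := by
  have hpow := pow_mul_of_pow_succ_eq_zero (by omega) hS hZ a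
  obtain ⟨y, hy⟩ := add_dvd_pow_sub (k := k) S W b
  rcases hjq.lt_or_eq with h | rfl
  -- T^(q(a+1)) is W^(q(a+1)) + (a+1)·S^q·W^(qa); the factor W^b kills the first term and S^(j-b)
  -- the second.
  · refine ⟨W ^ b * S ^ (j - b), ?_, (-1) ^ b, by simp, y * S ^ (j - b), ?_⟩
    · have hSj : S ^ q * S ^ (j - b) = 0 := by
        rw [← pow_add]
        exact pow_eq_zero_of_le (by omega) hS
      rw [if_pos h, hpow]
      rw [pow_add] at hW
      linear_combination S ^ (j - b) * hW + (a + 1) * W ^ (q * a) * W ^ b * hSj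
    · have : S ^ j = S ^ b * S ^ (j - b) := by rw [← pow_add]; congr 1; omega
      rw [this]
      linear_combination S ^ (j - b) * hy
  -- Here j = q. T^(qa+b) sends T^(q-b)·W^b to (a+1)·S^q·W^(qa+b) and S^q to S^q·W^(qa+b), so the
  -- difference dies.
  · refine ⟨(S + W) ^ (j - b) * W ^ b - ((a + 1 : ℕ) : R) * S ^ j, ?_,
      -((a + 1 : ℕ) : k), neg_ne_zero.mpr hak, ?_⟩
    · rw [if_neg (lt_irrefl _)]
      have h1 : (S + W) ^ (j * a + b) * (S + W) ^ (j - b) = (S + W) ^ (j * (a + 1)) := by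
        rw [← pow_add]
        congr 1
        rw [Nat.mul_succ]
        omega
      have h2 : (S + W) ^ (j * a + b) * S ^ j = S ^ j * W ^ (j * a + b) := by
        rw [mul_comm, pow_mul_add_pow hS]
      rw [pow_add] at hW
      rw [mul_sub, ← mul_assoc, h1, mul_left_comm, h2, hpow, pow_add W]
      push_cast
      linear_combination hW
    · have h1 : S + W ∣ (S + W) ^ (j - b) := dvd_pow_self _ (by omega)
      have h2 : (S + W) ^ (j - b) * W ^ b - ((a + 1 : ℕ) : R) * S ^ j -
          algebraMap k R (-((a + 1 : ℕ) : k)) * S ^ j = (S + W) ^ (j - b) * W ^ b := by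
        rw [map_neg, map_natCast]
        ring
      rw [h2]
      exact h1.mul_right _

/-- Because S^(q+1) = 0, powers of T^q have only two binomial terms. The coefficients a + 1 and a +
2 must be invertible, whence the bound on a. The summands of length divisible by q will vanish in
the stable ring. -/
theorem dl_succ_mul_dl (e a b : ℕ) (hb : 0 < b) (hbq : b < p ^ e) (hap : a + 2 < p) :
    dl k (p ^ e + 1) * dl k (p ^ e * (a + 1) + b) =
      dl k (p ^ e * (a + 2) + b) + (b - 1) • dl k (p ^ e * (a + 2)) +
      dl k (p ^ e * (a + 1) + (p ^ e - b)) + (p ^ e - b - 1) • dl k (p ^ e * (a + 1)) +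
      dl k (p ^ e * a + b) := by
  set q := p ^ e with hq
  have hak : ((a + 1 : ℕ) : k) ≠ 0 := by
    rw [Ne, CharP.cast_eq_zero_iff k p]
    exact Nat.not_dvd_of_pos_of_lt (by omega) (by omega)
  have hak' : ((a + 2 : ℕ) : k) ≠ 0 := by
    rw [Ne, CharP.cast_eq_zero_iff k p]
    exact Nat.not_dvd_of_pos_of_lt (by omega) (by omega)
  rw [dl_mul_dl_of_ring k p (q + 1) (q * (a + 1) + b) (fun j => if j = 0 then q * (a + 2) + b
      else if j < b then q * (a + 2) else if j = b then q * (a + 1) + (q - b)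
      else if j < q then q * (a + 1) else q * a + b)]
  · exact sum_range_of_five_values (dl k) b q hb hbq _ _ _ _ _
  · intro R _ _ S W hS hW hZ
    have hZ := hZ e
    rw [← hq] at hZ
    have hq0 : 0 < q := by omega
    have hpow := pow_mul_of_pow_succ_eq_zero hq0 hS hZ
    have hW2 : W ^ (q * (a + 2)) = 0 :=
      pow_eq_zero_of_le (by rw [show a + 2 = (a + 1) + 1 by rfl, Nat.mul_succ q (a + 1)]; omega) hW
    have hpow2 : (S + W) ^ (q * (a + 2)) = (a + 2) * (S ^ q * W ^ (q * (a + 1))) := by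
      have := hpow (a + 1)
      rw [show a + 1 + 1 = a + 2 by rfl, hW2] at this
      rw [this]
      push_cast
      ring
    suffices H : ∀ j < q + 1, ∃ g : R, (S + W) ^ (if j = 0 then q * (a + 2) + b
        else if j < b then q * (a + 2) else if j = b then q * (a + 1) + (q - b)
        else if j < q then q * (a + 1) else q * a + b) * g = 0 ∧
        ∃ u : k, u ≠ 0 ∧ S + W ∣ g - algebraMap k R u * S ^ j by
      choose! g hg using H
      exact ⟨g, hg⟩
    intro j hj
    rcases Nat.eq_zero_or_pos j with rfl | hj0
    · refine ⟨1, ?_, 1, one_ne_zero, by simp⟩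
      rw [if_pos rfl, pow_add, hpow2, mul_one, mul_assoc, mul_right_comm, pow_mul_add_pow hS]
      rw [pow_add] at hW
      linear_combination (a + 2) * S ^ q * hW
    rw [if_neg hj0.ne']
    rcases lt_trichotomy j b with h | rfl | h
    · rw [if_pos h]
      refine ⟨S ^ j, ?_, 1, one_ne_zero, by simp⟩
      have : S ^ q * S ^ j = 0 := by
        rw [← pow_add]
        exact pow_eq_zero_of_le (by omega) hS
      rw [hpow2]
      linear_combination (a + 2) * W ^ (q * (a + 1)) * this
    · rw [if_neg (lt_irrefl _), if_pos rfl]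
      obtain ⟨y, hy⟩ := add_dvd_pow_sub (k := k) S W j
      -- T^(q(a+1)+q-j) sends W^j to a + 1 times, and T^j to a + 2 times, the element
      -- S^q·W^(q(a+1)); r is the ratio that cancels them.
      set r : k := ((a + 1 : ℕ) : k) / ((a + 2 : ℕ) : k) with hr
      have hr' : algebraMap k R r * (a + 2) = a + 1 := by
        have : r * ((a + 2 : ℕ) : k) = ((a + 1 : ℕ) : k) := div_mul_cancel₀ _ hak'
        have := congrArg (algebraMap k R) this
        rw [map_mul, map_natCast, map_natCast] at this
        push_cast at this
        exact this
      refine ⟨W ^ j - algebraMap k R r * (S + W) ^ j, ?_, (-1) ^ j, by simp, ?_⟩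
      · have h1 : (S + W) ^ (q * (a + 1) + (q - j)) * (S + W) ^ j = (S + W) ^ (q * (a + 2)) := by
          rw [← pow_add]
          congr 1
          rw [show a + 2 = a + 1 + 1 by rfl, Nat.mul_succ q (a + 1)]
          omega
        have h2 : (S + W) ^ (q * (a + 1) + (q - j)) * W ^ j =
            (a + 1) * (S ^ q * W ^ (q * (a + 1))) := by
          have h3 : W ^ (q * (a + 1)) = W ^ (q * a) * (W ^ (q - j) * W ^ j) := by
            rw [← pow_add, ← pow_add]
            congr 1
            rw [Nat.mul_succ]
            omega
          rw [pow_add] at hW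
          have h4 := pow_mul_add_pow (W := W) hS (q - j)
          rw [pow_add, hpow, h3]
          rw [h3] at hW
          linear_combination (S + W) ^ (q - j) * hW + (a + 1) * W ^ (q * a) * W ^ j * h4
        rw [mul_sub, h2, mul_left_comm _ (algebraMap k R r), h1, hpow2]
        linear_combination -(S ^ q * W ^ (q * (a + 1))) * hr'
      · have h1 : S + W ∣ (S + W) ^ j := dvd_pow_self _ hj0.ne'
        have h2 : W ^ j - algebraMap k R r * (S + W) ^ j - algebraMap k R ((-1) ^ j) * S ^ j =
            (W ^ j - algebraMap k R ((-1) ^ j) * S ^ j) - algebraMap k R r * (S + W) ^ j := by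
          ring
        rw [h2]
        exact dvd_sub ⟨y, hy⟩ (h1.mul_left _)
    · rw [if_neg (by omega), if_neg (by omega)]
      exact exists_generator_of_lt k hb h (by omega) hak hS hW hZ
  · have h := sum_range_of_five_values (fun j => j) b q hb hbq (q * (a + 2) + b) (q * (a + 2))
      (q * (a + 1) + (q - b)) (q * (a + 1)) (q * a + b)
    rw [h]
    obtain ⟨b, rfl⟩ := Nat.exists_eq_add_of_lt hb
    obtain ⟨r, hr⟩ := Nat.exists_eq_add_of_lt hbq
    rw [hr, show 0 + b + 1 + r + 1 - (0 + b + 1) = r + 1 by omega]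
    simp
    ring

/-- The coefficient a + 2 is now zero in k, so T^(qp) kills everything and the longer summands
collapse to length qp. Their number x is irrelevant, since they vanish in the stable ring. -/
theorem dl_succ_mul_dl_last (e a b : ℕ) (hb : 0 < b) (hbq : b < p ^ e) (hap : a + 2 = p) :
    ∃ x : ℕ, dl k (p ^ e + 1) * dl k (p ^ e * (a + 1) + b) =
      x • dl k (p ^ e * (a + 2)) + (p ^ e - b - 1) • dl k (p ^ e * (a + 1)) +
      dl k (p ^ e * a + b) := by
  set q := p ^ e with hq
  have hak : ((a + 1 : ℕ) : k) ≠ 0 := by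
    rw [Ne, CharP.cast_eq_zero_iff k p]
    exact Nat.not_dvd_of_pos_of_lt (by omega) (by omega)
  refine ⟨b + 1, ?_⟩
  rw [dl_mul_dl_of_ring k p (q + 1) (q * (a + 1) + b) (fun j => if j = 0 then q * (a + 2)
      else if j < b then q * (a + 2) else if j = b then q * (a + 2)
      else if j < q then q * (a + 1) else q * a + b)]
  · rw [sum_range_of_five_values (dl k) b q hb hbq]
    obtain ⟨b, rfl⟩ := Nat.exists_eq_add_of_lt hb
    simp only [zero_add, Nat.add_sub_cancel]
    module
  · intro R _ _ S W hS hW hZ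
    have hZ := hZ e
    rw [← hq] at hZ
    have hq0 : 0 < q := by omega
    have hpow := pow_mul_of_pow_succ_eq_zero hq0 hS hZ
    have hW2 : W ^ (q * (a + 2)) = 0 :=
      pow_eq_zero_of_le (by rw [show a + 2 = (a + 1) + 1 by rfl, Nat.mul_succ q (a + 1)]; omega) hW
    have hpow2 : (S + W) ^ (q * (a + 2)) = 0 := by
      have h1 := hpow (a + 1)
      have h2 : ((a + 2 : ℕ) : R) = 0 := by
        rw [← map_natCast (algebraMap k R), hap, CharP.cast_eq_zero, map_zero]
      push_cast at h2 h1
      rw [show a + 1 + 1 = a + 2 by rfl, hW2] at h1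
      rw [h1]
      linear_combination S ^ q * W ^ (q * (a + 1)) * h2
    suffices H : ∀ j < q + 1, ∃ g : R, (S + W) ^ (if j = 0 then q * (a + 2)
        else if j < b then q * (a + 2) else if j = b then q * (a + 2)
        else if j < q then q * (a + 1) else q * a + b) * g = 0 ∧
        ∃ u : k, u ≠ 0 ∧ S + W ∣ g - algebraMap k R u * S ^ j by
      choose! g hg using H
      exact ⟨g, hg⟩
    intro j hj
    rcases le_or_gt j b with h | h
    · have hval : (if j = 0 then q * (a + 2)
        else if j < b then q * (a + 2) else if j = b then q * (a + 2)
        else if j < q then q * (a + 1) else q * a + b) = q * (a + 2) := by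
        rcases h.lt_or_eq with h | h
        · rw [if_pos h, ite_self]
        · rw [if_pos h, ite_self, ite_self]
      rw [hval, hpow2]
      exact ⟨S ^ j, zero_mul _, 1, one_ne_zero, by simp⟩
    · rw [if_neg (by omega), if_neg (by omega), if_neg (by omega)]
      exact exists_generator_of_lt k hb h (by omega) hak hS hW hZ
  · have h := sum_range_of_five_values (fun j => j) b q hb hbq (q * (a + 2)) (q * (a + 2))
      (q * (a + 2)) (q * (a + 1)) (q * a + b)
    rw [h]
    obtain ⟨b, rfl⟩ := Nat.exists_eq_add_of_lt hb
    obtain ⟨r, hr⟩ := Nat.exists_eq_add_of_lt hbq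
    rw [hr, show 0 + b + 1 + r + 1 - (0 + b + 1) = r + 1 by omega]
    simp
    ring

end Pieri
end HilbertKunz
-- Three-term recurrences and symmetric windows
namespace HilbertKunz

section Fusion

variable {A : Type*} [CommRing A]

/-- Symmetric pairs in a sequence of length `2 * m + 1`. -/
def symPair (x : ℕ → A) (m c : ℕ) : A := x (m - c) + x (m + c)

theorem symPair_zero (x : ℕ → A) (m : ℕ) : symPair x m 0 = 2 * x m := by
  rw [symPair, Nat.sub_zero, add_zero, two_mul]

/-- Symmetric windows in a sequence of length `2 * m + 1`. -/
def symWindow (x : ℕ → A) (m r : ℕ) : A := x m + ∑ c ∈ Finset.range r, symPair x m (c + 1)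

theorem symWindow_zero (x : ℕ → A) (m : ℕ) : symWindow x m 0 = x m := by simp [symWindow]

theorem symWindow_succ (x : ℕ → A) (m r : ℕ) :
    symWindow x m (r + 1) = symWindow x m r + symPair x m (r + 1) := by
  rw [symWindow, Finset.sum_range_succ, symWindow, add_assoc]

variable {x : ℕ → A} {y : A} {m : ℕ}

theorem mul_symPair_succ (h : ∀ a, a + 2 ≤ 2 * m → y * x (a + 1) = x a + x (a + 1) + x (a + 2))
    {c : ℕ} (hc : c + 2 ≤ m) :
    y * symPair x m (c + 1) = symPair x m c + symPair x m (c + 1) + symPair x m (c + 2) := by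
  obtain ⟨r, rfl⟩ := Nat.exists_eq_add_of_le hc
  have h1 := h r (by omega)
  have h2 := h (c + 2 + r + c) (by omega)
  simp only [symPair]
  rw [show c + 2 + r - (c + 1) = r + 1 by omega, show c + 2 + r - c = r + 2 by omega,
    show c + 2 + r - (c + 2) = r by omega, ← add_assoc (c + 2 + r) c 1,
    ← add_assoc (c + 2 + r) c 2, mul_add, h1, h2]
  ring

theorem mul_symWindow_zero
    (h : ∀ a, a + 2 ≤ 2 * m → y * x (a + 1) = x a + x (a + 1) + x (a + 2)) (hm : 0 < m) :
    y * symWindow x m 0 = symWindow x m 1 := by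
  obtain ⟨r, rfl⟩ := Nat.exists_eq_add_of_lt hm
  have h1 := h r (by omega)
  rw [symWindow_succ, symWindow_zero, symPair, zero_add, zero_add, Nat.add_sub_cancel, h1]
  ring

theorem mul_symWindow_succ
    (h : ∀ a, a + 2 ≤ 2 * m → y * x (a + 1) = x a + x (a + 1) + x (a + 2)) {r : ℕ}
    (hr : r + 2 ≤ m) :
    y * symWindow x m (r + 1) = symWindow x m r + symWindow x m (r + 1) + symWindow x m (r + 2) := by
  induction r with
  | zero =>
    rw [symWindow_succ, mul_add, mul_symWindow_zero h (by omega), mul_symPair_succ h hr,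
      symWindow_succ x m 1, symWindow_succ, symWindow_zero, symPair_zero]
    ring
  | succ r ih =>
    rw [symWindow_succ, mul_add, ih (by omega), mul_symPair_succ h hr, symWindow_succ x m (r + 2),
      symWindow_succ x m (r + 1), symWindow_succ x m r]
    ring

/-- The boundary relations have no x 0 term in y * x 0 and no x (2 * m) term in y * x (2 * m), so
the full window reflects instead of growing. -/
theorem mul_symWindow_top
    (h : ∀ a, a + 2 ≤ 2 * m → y * x (a + 1) = x a + x (a + 1) + x (a + 2))
    (h0 : y * x 0 = x 1) (hlast : y * x (2 * m) = x (2 * m - 1)) (hm : 0 < m) :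
    y * symWindow x m m = symWindow x m m + 2 * symWindow x m (m - 1) := by
  have hQ : y * symPair x m m = symPair x m (m - 1) := by
    rw [symPair, symPair, Nat.sub_self, mul_add, h0, ← two_mul, hlast,
      show m - (m - 1) = 1 by omega, show m + (m - 1) = 2 * m - 1 by omega]
  obtain ⟨r, rfl⟩ := Nat.exists_eq_add_of_lt hm
  rw [zero_add] at *
  rw [Nat.add_sub_cancel] at *
  rw [symWindow_succ, mul_add, hQ]
  rcases r with - | r
  · rw [mul_symWindow_zero h hm, symWindow_succ, symWindow_zero]
    simp only [symPair]
    simp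
    ring
  · rw [mul_symWindow_succ h le_rfl, symWindow_succ _ _ (r + 1), symWindow_succ]
    ring

/-- The recurrence makes x m a polynomial g in y times x 0. Then g * x j is the window of radius j
about m for j ≤ m, and g * x (m + i) the one of radius m - i, since both sides obey the same
recurrence. A pair thus goes to twice a window, and `symPair x m 0` is subtracted because it already
contains x m twice. -/
theorem exists_mul_symPair_eq (hm : 0 < m)
    (h : ∀ a, a + 2 ≤ 2 * m → y * x (a + 1) = x a + x (a + 1) + x (a + 2))
    (h0 : y * x 0 = x 1) (hlast : y * x (2 * m) = x (2 * m - 1)) :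
    ∃ g : A, g * x 0 = x m ∧ ∀ c ≤ m, g * symPair x m c =
      2 * ∑ c' ∈ Finset.range (m - c + 1), symPair x m c' - symPair x m 0 := by
  have hV : ∃ V : ℕ → A, ∀ a ≤ 2 * m, V a * x 0 = x a := by
    -- The pair (V a, V (a+1)) is iterated, with V (a+2) = y * V (a+1) - V (a+1) - V a.
    refine ⟨fun a => Nat.rec (motive := fun _ => A × A) (1, y)
      (fun _ z => (z.2, y * z.2 - z.2 - z.1)) a |>.1, fun a => ?_⟩
    induction a using Nat.twoStepInduction with
    | zero => simp
    | one => intro _; exact h0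
    | more a ih1 ih2 =>
      intro ha
      have e1 := ih1 (by omega)
      have e2 := ih2 (by omega)
      have e3 := h a ha
      simp only at e1 e2 ⊢
      linear_combination y * e2 - e2 - e1 + e3
  obtain ⟨V, hV⟩ := hV
  refine ⟨V m, hV m (by omega), ?_⟩
  set g := V m with hg
  have hg0 : g * x 0 = symWindow x m 0 := by rw [symWindow_zero]; exact hV m (by omega)
  have hlow : ∀ j ≤ m, g * x j = symWindow x m j := by
    intro j
    induction j using Nat.twoStepInduction with
    | zero => exact fun _ => hg0
    | one =>
      intro _
      rw [← h0, mul_left_comm, hg0, mul_symWindow_zero h hm]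
    | more j ih1 ih2 =>
      intro hj
      have e1 := ih1 (by omega)
      have e2 := ih2 (by omega)
      have e3 := h j (by omega)
      have e4 := mul_symWindow_succ h (r := j) hj
      linear_combination -g * e3 + (y - 1) * e2 - e1 + e4
  have hhigh : ∀ i ≤ m, g * x (m + i) = symWindow x m (m - i) := by
    intro i
    induction i using Nat.twoStepInduction with
    | zero => exact fun _ => hlow m le_rfl
    | one =>
      intro _
      have e1 := hlow (m - 1) (by omega)
      have e2 := hlow m le_rfl
      have e3 := h (m - 1) (by omega)
      have e4 := mul_symWindow_top h h0 hlast hm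
      rw [show m - 1 + 1 = m by omega, show m - 1 + 2 = m + 1 by omega] at e3
      linear_combination -g * e3 + (y - 1) * e2 - e1 + e4
    | more i ih1 ih2 =>
      intro hi
      have e1 := ih1 (by omega)
      have e2 := ih2 (by omega)
      have e3 := h (m + i) (by omega)
      have e4 := mul_symWindow_succ h (r := m - (i + 2)) (by omega)
      rw [show m - (i + 2) + 1 = m - (i + 1) by omega,
        show m - (i + 2) + 2 = m - i by omega] at e4
      rw [← add_assoc] at e2 ⊢
      linear_combination -g * e3 + (y - 1) * e2 - e1 + e4
  intro c hc
  rw [symPair, mul_add, hlow _ (by omega), hhigh c hc, Finset.sum_range_succ', symWindow, symPair,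
    Nat.sub_zero, add_zero]
  ring

end Fusion

section Window

variable {A : Type*} [CommRing A] {x : ℕ → A} {m : ℕ}

/-- In a quotient of the ring generated by `x 2` with `x b` the Chebyshev polynomials in `x 2`. -/
theorem mul_pair_eq (hm : 0 < m) (h0 : x 0 = 0) (h1 : x 1 = 1) (hlast : x (2 * m + 1) = 0)
    (h : ∀ b < 2 * m, x 2 * x (b + 1) = x (b + 2) + x b) {c : ℕ} (hc : c < m) :
    (x m + x (m + 1)) * (x (m - c) + x (m + 1 + c)) =
      2 * ∑ c' ∈ Finset.range (m - c), (x (m - c') + x (m + 1 + c')) := by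
  set P : ℕ → A := fun c => x (m - c) + x (m + 1 + c) with hP
  set B : ℕ → A := fun r => ∑ c ∈ Finset.range r, P c with hB
  have hB0 : B 0 = 0 := by simp [hB]
  have hBs : ∀ r, B (r + 1) = B r + P r := fun r => Finset.sum_range_succ _ _
  -- The outermost pair is x 0 + x (2 * m + 1), so the windows B stop growing at m; this is what
  -- reflects them in `hhigh`.
  have hPm : P m = 0 := by
    simp only [hP, Nat.sub_self, h0, zero_add]
    rw [← hlast]
    congr 1
    ring
  have hP0 : x 2 * P 0 = P 0 + P 1 := by
    simp only [hP, Nat.sub_zero, add_zero, mul_add]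
    obtain ⟨r, rfl⟩ := Nat.exists_eq_add_of_lt hm
    rw [h (0 + r) (by omega), h (0 + r + 1) (by omega)]
    simp only [zero_add, Nat.add_sub_cancel]
    ring
  have hPs : ∀ c, c + 2 ≤ m → x 2 * P (c + 1) = P c + P (c + 2) := by
    intro c hc
    obtain ⟨r, rfl⟩ := Nat.exists_eq_add_of_le hc
    simp only [hP]
    have e1 := h r (by omega)
    have e2 := h (c + 2 + r + 1 + c) (by omega)
    rw [show c + 2 + r - (c + 1) = r + 1 by omega, show c + 2 + r - c = r + 2 by omega,
      show c + 2 + r - (c + 2) = r by omega, ← add_assoc _ c 1, ← add_assoc _ c 2, mul_add, e1, e2]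
    ring
  have hyB : ∀ r, r + 1 ≤ m → x 2 * B (r + 1) = B (r + 2) + B r := by
    intro r
    induction r with
    | zero =>
      intro _
      rw [hBs, hB0, hBs, hBs, hB0, zero_add, hP0, add_zero]
    | succ r ih =>
      intro hr
      rw [hBs, mul_add, ih (by omega), hPs r hr, hBs (r + 2), hBs r]
      ring
  have hBm : B (m + 1) = B m := by rw [hBs, hPm, add_zero]
  have hE : x m + x (m + 1) = B 1 := by simp [hB, hP]
  have hlow : ∀ b ≤ m + 1, (x m + x (m + 1)) * x b = B b := by
    intro b
    induction b using Nat.twoStepInduction with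
    | zero => intro _; rw [h0, mul_zero, hB0]
    | one => intro _; rw [h1, mul_one, hE]
    | more b ih1 ih2 =>
      intro hb
      have e1 := ih1 (by omega)
      have e2 := ih2 (by omega)
      have e3 := h b (by omega)
      have e4 := hyB b (by omega)
      linear_combination -(x m + x (m + 1)) * e3 + x 2 * e2 - e1 + e4
  have hhigh : ∀ i ≤ m, (x m + x (m + 1)) * x (m + 1 + i) = B (m - i) := by
    intro i
    induction i using Nat.twoStepInduction with
    | zero => intro _; rw [add_zero, hlow _ le_rfl, hBm, Nat.sub_zero]
    | one =>
      intro _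
      have e1 := hlow m (by omega)
      have e2 := hlow (m + 1) le_rfl
      have e3 := h m (by omega)
      have e4 := hyB (m - 1) (by omega)
      rw [show m - 1 + 1 = m by omega, show m - 1 + 2 = m + 1 by omega] at e4
      linear_combination -(x m + x (m + 1)) * e3 + x 2 * e2 - e1 + e4 + (x 2 + 1) * hBm
    | more i ih1 ih2 =>
      intro hi
      have e1 := ih1 (by omega)
      have e2 := ih2 (by omega)
      have e3 := h (m + 1 + i) (by omega)
      have e4 := hyB (m - (i + 2)) (by omega)
      rw [show m - (i + 2) + 1 = m - (i + 1) by omega,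
        show m - (i + 2) + 2 = m - i by omega] at e4
      rw [← add_assoc] at e2 ⊢
      linear_combination -(x m + x (m + 1)) * e3 + x 2 * e2 - e1 + e4
  rw [mul_add, hlow _ (by omega), hhigh c (by omega), two_mul]

end Window
end HilbertKunz
-- The stable ring and the recursion for block numbers
namespace HilbertKunz

section Recursion

variable (k : Type) [Field k]

/-- The class of `k[X] / (X ^ N)` with `T` acting as multiplication by `X ^ 2`. -/
noncomputable def sq (N : ℕ) : IsoClass k := IsoClass.mk ((MarkedAlg.cyc k N).frob 2)

theorem cl_sq (s : ℕ) : cl (sq k (2 * s + 1)) = dl k s + dl k (s + 1) := by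
  rw [sq, cl_frob_cyc 2 (2 * s + 1) two_ne_zero (fun i => s + 1 - i)]
  · simp [Finset.sum_range_succ, add_comm]
  · intro i hi
    omega
  · simp [Finset.sum_range_succ]
    ring

theorem sum_range_two_mul_ite {M : Type*} [AddCommMonoid M] (F : ℕ → M) (q m : ℕ) :
    ∑ i ∈ Finset.range (2 * q), F (if i < q then m + 1 else m) = q • (F m + F (m + 1)) := by
  have h2 : ∀ i ∈ Finset.range q, F (if q + i < q then m + 1 else m) = F m :=
    fun i _ => by rw [if_neg (by omega)]
  rw [two_mul, Finset.sum_range_add, Finset.sum_congr rfl fun i hi => by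
    rw [if_pos (Finset.mem_range.mp hi)], Finset.sum_congr rfl h2]
  simp [add_comm]

/-- T now acts as X^(2q), and the powers X^i with i < 2q generate: q summands of each of the two
lengths. -/
theorem cl_frob_sq (q m : ℕ) (hq : q ≠ 0) :
    cl ((sq k (q * (2 * m + 1))).frob q) = q • (dl k m + dl k (m + 1)) := by
  have h : (sq k (q * (2 * m + 1))).frob q =
      IsoClass.mk ((MarkedAlg.cyc k (q * (2 * m + 1))).frob (2 * q)) := by
    rw [sq, IsoClass.frob_mk]
    congr 1
    simp only [MarkedAlg.frob]
    congr 1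
    exact (pow_mul _ _ _).symm
  rw [h, cl_frob_cyc (2 * q) _ (by omega) (fun i => if i < q then m + 1 else m),
    sum_range_two_mul_ite (dl k)]
  · intro i hi
    split_ifs with h
    · nlinarith
    · nlinarith
  · rw [sum_range_two_mul_ite fun i => i, smul_eq_mul]
    ring

theorem cl_frob_cyc_mul_add (q a b : ℕ) (hq : q ≠ 0) (hb : b ≤ q) :
    cl ((IsoClass.mk (MarkedAlg.cyc k (q * a + b))).frob q) =
      b • dl k (a + 1) + (q - b) • dl k a := by
  obtain ⟨r, rfl⟩ := Nat.exists_eq_add_of_le hb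
  rw [IsoClass.frob_mk, cl_frob_cyc (b + r) _ hq (fun i => if i < b then a + 1 else a),
    Finset.sum_range_add, Finset.sum_congr rfl fun i hi => by rw [if_pos (Finset.mem_range.mp hi)],
    Finset.sum_congr (s₂ := Finset.range r) (g := fun _ => dl k a) rfl fun i _ => by
        rw [if_neg (by omega)]]
  · simp
  · intro i hi
    split_ifs with h
    · nlinarith
    · nlinarith
  · rw [Finset.sum_range_add, Finset.sum_congr rfl fun i hi => by
        rw [if_pos (Finset.mem_range.mp hi)],
      Finset.sum_congr (s₂ := Finset.range r) (g := fun _ => a) rfl fun i _ => by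
        rw [if_neg (by omega)]]
    simp
    ring

theorem alpha_one : alpha k 1 = 1 := by rw [← dl_one, alpha_dl one_ne_zero]

variable (p : ℕ) [Fact p.Prime] [CharP k p]

/-- The ring obtained by killing the projective module `dl (p ^ e)`. -/
def StableRing (e : ℕ) : Type 1 := GreenRing k ⧸ Ideal.span {dl k (p ^ e)}

noncomputable instance (e : ℕ) : CommRing (StableRing k p e) :=
  inferInstanceAs (CommRing (GreenRing k ⧸ Ideal.span {dl k (p ^ e)}))

noncomputable instance (e : ℕ) : Algebra ℚ (StableRing k p e) :=
  inferInstanceAs (Algebra ℚ (GreenRing k ⧸ Ideal.span {dl k (p ^ e)}))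

/-- The class of an element of the representation ring in the stable ring. -/
noncomputable def toStable (e : ℕ) : GreenRing k →ₐ[ℚ] StableRing k p e :=
  Ideal.Quotient.mkₐ ℚ (Ideal.span {dl k (p ^ e)})

theorem dl_mul_self (e : ℕ) : dl k (p ^ e) * dl k (p ^ e) = p ^ e • dl k (p ^ e) := by
  simpa using dl_mul_dl_mul k p e 1

theorem prime_pow_ne_zero (e : ℕ) : ((p ^ e : ℕ) : ℚ) ≠ 0 :=
  Nat.cast_ne_zero.mpr (pow_ne_zero _ (Fact.out : p.Prime).ne_zero)

/-- The functional counting blocks on the stable ring. -/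
noncomputable def stableAlpha (e : ℕ) : StableRing k p e →ₗ[ℚ] ℚ :=
  (Submodule.liftQ ((Ideal.span {dl k (p ^ e)}).restrictScalars ℚ)
    -- As δ_q² = qδ_q, δ_q/q is idempotent; this is α composed with multiplication by the
    -- complementary idempotent.
    (alpha k - ((p ^ e : ℕ) : ℚ)⁻¹ • (alpha k).comp (LinearMap.mulLeft ℚ (dl k (p ^ e)))) (by
      intro x hx
      obtain ⟨x, rfl⟩ := Ideal.mem_span_singleton.mp hx
      rw [LinearMap.mem_ker, LinearMap.sub_apply, LinearMap.smul_apply, LinearMap.comp_apply,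
        LinearMap.mulLeft_apply, ← mul_assoc, dl_mul_self, smul_mul_assoc, map_nsmul,
        ← Nat.cast_smul_eq_nsmul ℚ, inv_smul_smul₀ (prime_pow_ne_zero p e), sub_self])).comp
    (Submodule.Quotient.restrictScalarsEquiv ℚ (Ideal.span {dl k (p ^ e)})).symm.toLinearMap

theorem stableAlpha_toStable (e : ℕ) (x : GreenRing k) :
    stableAlpha k p e (toStable k p e x) =
      alpha k x - ((p ^ e : ℕ) : ℚ)⁻¹ * alpha k (dl k (p ^ e) * x) := rfl

theorem stableAlpha_cl (e : ℕ) (x : IsoClass k) :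
    stableAlpha k p e (toStable k p e (cl x)) =
      alpha k (cl x) - ((p ^ e : ℕ) : ℚ)⁻¹ * alpha k (cl (x.frob (p ^ e))) := by
  rw [stableAlpha_toStable, alpha_dl_mul_cl]

/-- q·δ_{qa} is a multiple of δ_q, and q is invertible in ℚ. -/
theorem toStable_dl_mul (e a : ℕ) : toStable k p e (dl k (p ^ e * a)) = 0 := by
  have h := congrArg (toStable k p e) (dl_mul_dl_mul k p e a)
  have h0 : toStable k p e (dl k (p ^ e)) = 0 :=
    Ideal.Quotient.eq_zero_iff_mem.mpr (Ideal.mem_span_singleton_self _)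
  rw [map_mul, h0, zero_mul, map_nsmul, ← Nat.cast_smul_eq_nsmul ℚ] at h
  exact (smul_eq_zero.mp h.symm).resolve_left (prime_pow_ne_zero p e)

theorem alpha_smul_pow (q n : ℕ) (x : GreenRing k) :
    alpha k ((q • x) ^ n) = (q : ℚ) ^ n * alpha k (x ^ n) := by
  rw [_root_.smul_pow, map_nsmul, nsmul_eq_mul]
  push_cast
  rfl

/-- The Frobenius pullback of the class for q(2m+1) is q times the class for 2m+1; the correction is
therefore q^(d+1)/q times a block number. -/
theorem stableAlpha_sq_mul (e m d : ℕ) :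
    stableAlpha k p e (toStable k p e (cl (sq k (p ^ e * (2 * m + 1)) ^ (d + 1)))) =
      (sq k (p ^ e * (2 * m + 1)) ^ (d + 1)).blocks -
        ((p ^ e : ℕ) : ℚ) ^ d * (sq k (2 * m + 1) ^ (d + 1)).blocks := by
  have hq := prime_pow_ne_zero p e
  rw [stableAlpha_cl, alpha_cl, IsoClass.frob_pow, map_pow, cl_frob_sq k (p ^ e) m (by exact_mod_cast hq),
    alpha_smul_pow, ← cl_sq, ← map_pow, alpha_cl, pow_succ ((p ^ e : ℕ) : ℚ)]
  field_simp

theorem stableAlpha_sq (e d : ℕ) :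
    stableAlpha k p e (toStable k p e (cl (sq k (p ^ e) ^ (d + 1)))) =
      (sq k (p ^ e) ^ (d + 1)).blocks - ((p ^ e : ℕ) : ℚ) ^ d := by
  have h := stableAlpha_sq_mul k p e 0 d
  have h1 : ((sq k 1 ^ (d + 1)).blocks : ℚ) = 1 := by
    have := cl_sq k 0
    rw [mul_zero, zero_add, dl_zero, dl_one, zero_add] at this
    rw [← alpha_cl, map_pow, this, one_pow, alpha_one]
  rwa [mul_zero, zero_add, mul_one, h1, mul_one] at h

theorem exists_mk_eq_pow (e : ℕ) (M : MarkedAlg k) (hM : M.t ^ p ^ e = 0) (n : ℕ) :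
    ∃ N : MarkedAlg k, IsoClass.mk N = IsoClass.mk M ^ n ∧ N.t ^ p ^ e = 0 := by
  induction n with
  | zero =>
    exact ⟨MarkedAlg.unit k, by rw [pow_zero]; rfl,
      zero_pow (pow_ne_zero _ (Fact.out : p.Prime).ne_zero)⟩
  | succ n ih =>
    obtain ⟨N, hN, hN'⟩ := ih
    refine ⟨N.tensor M, by rw [← IsoClass.mk_mul_mk, hN, pow_succ], ?_⟩
    have h : ((N.tensor M).frob (p ^ e)).t = (N.tensor M).t ^ p ^ e := rfl
    have h2 : ((N.frob (p ^ e)).tensor (M.frob (p ^ e))).t =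
        (N.t ^ p ^ e) ⊗ₜ[k] (1 : M.A) + (1 : N.A) ⊗ₜ[k] (M.t ^ p ^ e) := rfl
    have h3 : ((N.frob (p ^ e)).tensor (M.frob (p ^ e))).t = 0 := by
      rw [h2, hN', hM, TensorProduct.zero_tmul, TensorProduct.tmul_zero, add_zero]
      rfl
    rw [← MarkedAlg.frob_tensor] at h3
    exact h3

/-- T^q kills the module with class `sq k (p ^ e) ^ d`, so tensoring it with any cyclic module of
length at least q gives its full dimension q^d as block number. The pullback of the product has
q^d·q blocks, and the correction cancels exactly. -/
theorem stableAlpha_sq_pow_mul_dl (e d a b : ℕ) (hb : b ≤ p ^ e) :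
    stableAlpha k p e (toStable k p e (cl (sq k (p ^ e) ^ d) * dl k (p ^ e * (a + 1) + b))) = 0 := by
  have hq := prime_pow_ne_zero p e
  have hq0 : p ^ e ≠ 0 := by exact_mod_cast hq
  have hfrob : cl ((sq k (p ^ e)).frob (p ^ e)) = p ^ e • (1 : GreenRing k) := by
    have := cl_frob_sq k (p ^ e) 0 hq0
    rwa [mul_zero, zero_add, mul_one, dl_zero, dl_one, zero_add] at this
  have h1 : ((MarkedAlg.cyc k (p ^ e)).frob 2).t ^ p ^ e = 0 := by
    have : (TruncPoly.x k (p ^ e) ^ 2) ^ p ^ e = 0 := by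
      rw [pow_right_comm, TruncPoly.x_pow, zero_pow two_ne_zero]
    exact this
  obtain ⟨N, hN, hN'⟩ := exists_mk_eq_pow k p e _ h1 d
  have h2 : alpha k (cl (sq k (p ^ e) ^ d) * dl k (p ^ e * (a + 1) + b)) =
      ((p ^ e : ℕ) : ℚ) ^ d := by
    rw [sq, ← hN, mul_comm, alpha_dl_mul_cl_of_pow_eq_zero N hN'
      (show p ^ e ≤ p ^ e * (a + 1) + b by nlinarith), hN, ← sq, alpha_dl_mul_cl,
      IsoClass.frob_pow, map_pow, hfrob, alpha_smul_pow, one_pow, alpha_one, mul_one]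
  have h3 : alpha k (dl k (p ^ e) * (cl (sq k (p ^ e) ^ d) * dl k (p ^ e * (a + 1) + b))) =
      ((p ^ e : ℕ) : ℚ) ^ d * (p ^ e : ℕ) := by
    rw [dl.eq_def k (p ^ e * (a + 1) + b), ← map_mul, alpha_dl_mul_cl, IsoClass.frob_mul,
      IsoClass.frob_pow, map_mul, map_pow, hfrob, cl_frob_cyc_mul_add k _ _ _ hq0 hb,
      _root_.smul_pow, one_pow, smul_one_mul, map_nsmul, map_add, map_nsmul, map_nsmul,
      alpha_dl (by omega), alpha_dl (by omega)]
    simp only [nsmul_eq_mul, mul_one]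
    push_cast [Nat.cast_sub hb]
    ring
  rw [stableAlpha_toStable, h2, h3, mul_comm (_ ^ d), inv_mul_cancel_left₀ hq, sub_self]

/-- Weighted numbers of closed walks controlling the product of the stable classes. -/
def stableWalks (m : ℕ) : ℕ → ℕ → ℚ
  | 0, c => if c = m then 1 else 0
  | i + 1, c => 2 * ∑ c' ∈ Finset.range (m - c + 1), stableWalks m i c' - stableWalks m i 0

/-- In the stable ring the classes for q and pq are x 0 and x m = g * x 0, so (x m)^(d+1) is half of
(x 0)^d * g^d * `symPair x m 0`. Only the x 0 occurring in the expansion of g^d * `symPair x m 0`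
contributes to the functional. -/
theorem blocks_sq_prime_mul (m e s d : ℕ) (hp : p = 2 * m + 1) (hm : 0 < m)
    (hq : p ^ e = 2 * s + 1) (hs : 0 < s) :
    ((sq k (p ^ e * p) ^ (d + 1)).blocks : ℚ) =
      ((p ^ e : ℕ) : ℚ) ^ d * (sq k p ^ (d + 1)).blocks +
      stableWalks m d 0 / 2 * ((sq k (p ^ e) ^ (d + 1)).blocks - ((p ^ e : ℕ) : ℚ) ^ d) := by
  set π := toStable k p e with hπ
  set κ : ℕ → ℕ → StableRing k p e := fun a b => π (dl k (p ^ e * a + b)) with hκ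
  set x : ℕ → StableRing k p e := fun a => κ a s + κ a (s + 1) with hx
  set y := π (dl k (p ^ e + 1)) with hy
  have hz : ∀ a, π (dl k (p ^ e * a)) = 0 := toStable_dl_mul k p e
  have hz1 : π (dl k (p ^ e)) = 0 := by simpa using hz 1
  have hκ0 : ∀ b, 0 < b → b < p ^ e → y * κ 0 b = κ 1 b := by
    intro b hb hbq
    have h := congrArg π (dl_mul_dl_succ k p e b hb hbq)
    rw [map_mul, map_add, map_nsmul, hz1, smul_zero, add_zero] at h
    simp only [hκ, mul_zero, zero_add, mul_one]
    rw [← h, mul_comm]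
  have hκs : ∀ a b, 0 < b → b < p ^ e → a + 2 < p →
      y * κ (a + 1) b = κ (a + 2) b + κ (a + 1) (p ^ e - b) + κ a b := by
    intro a b hb hbq ha
    have h := congrArg π (dl_succ_mul_dl k p e a b hb hbq ha)
    simpa [hz] using h
  have hκl : ∀ a b, 0 < b → b < p ^ e → a + 2 = p → y * κ (a + 1) b = κ a b := by
    intro a b hb hbq ha
    obtain ⟨w, h⟩ := dl_succ_mul_dl_last k p e a b hb hbq ha
    simpa [hz] using congrArg π h
  have hs1 : s + 1 < p ^ e := by omega
  -- The reflection b ↦ q - b in the product formula exchanges s and s + 1, and so fixes x a.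
  have hqs : p ^ e - s = s + 1 := by omega
  have hqs1 : p ^ e - (s + 1) = s := by omega
  have hx0 : y * x 0 = x 1 := by
    simp only [hx, mul_add, hκ0 s hs (by omega), hκ0 (s + 1) (by omega) hs1]
  have hxs : ∀ a, a + 2 ≤ 2 * m → y * x (a + 1) = x a + x (a + 1) + x (a + 2) := by
    intro a ha
    simp only [hx, mul_add, hκs a s hs (by omega) (by omega),
      hκs a (s + 1) (by omega) hs1 (by omega), hqs, hqs1]
    ring
  have hxl : y * x (2 * m) = x (2 * m - 1) := by
    obtain ⟨r, hr⟩ : ∃ r, 2 * m = r + 1 := ⟨2 * m - 1, by omega⟩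
    rw [hr, Nat.add_sub_cancel]
    simp only [hx, mul_add, hκl r s hs (by omega) (by omega),
      hκl r (s + 1) (by omega) hs1 (by omega)]
  obtain ⟨g, hg0, hg⟩ := exists_mul_symPair_eq hm hxs hx0 hxl
  have hX0 : π (cl (sq k (p ^ e))) = x 0 := by
    rw [hq, cl_sq, map_add]
    simp [hx, hκ]
  have hXm : π (cl (sq k (p ^ e * p))) = x m := by
    have h1 : p ^ e * p = 2 * (p ^ e * m + s) + 1 := by
      calc p ^ e * p = p ^ e * (2 * m + 1) := by rw [← hp]
        _ = 2 * (p ^ e * m) + p ^ e := by ring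
        _ = _ := by omega
    rw [h1, cl_sq, map_add]
    rfl
  set C : ℚ := stableAlpha k p e (x 0 ^ d * x 0) with hC
  have hzero : ∀ a, stableAlpha k p e (x 0 ^ d * x (a + 1)) = 0 := by
    intro a
    rw [← hX0, ← map_pow, ← map_pow]
    simp only [hx, hκ]
    rw [mul_add, map_add, ← map_mul, ← map_mul, stableAlpha_sq_pow_mul_dl k p e d a s (by omega),
      stableAlpha_sq_pow_mul_dl k p e d a (s + 1) (by omega), add_zero]
  -- At i = 0 only the pair with c = m contains x 0; each factor g applies the recursion defining
  -- `stableWalks`.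
  have hwalk : ∀ i c, c ≤ m → stableAlpha k p e (x 0 ^ d * (g ^ i * symPair x m c)) =
      C * stableWalks m i c := by
    intro i
    induction i with
    | zero =>
      intro c hc
      rw [pow_zero, one_mul, symPair, mul_add, map_add, stableWalks]
      have h2 : stableAlpha k p e (x 0 ^ d * x (m + c)) = 0 := by
        obtain ⟨r, hr⟩ : ∃ r, m + c = r + 1 := ⟨m + c - 1, by omega⟩
        rw [hr, hzero]
      rw [h2, add_zero]
      split_ifs with h
      · rw [h, Nat.sub_self, mul_one]
      · obtain ⟨r, hr⟩ : ∃ r, m - c = r + 1 := ⟨m - c - 1, by omega⟩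
        rw [hr, hzero, mul_zero]
    | succ i ih =>
      intro c hc
      rw [pow_succ, mul_assoc, hg c hc, mul_sub, mul_sub, map_sub, ih 0 (Nat.zero_le _),
        stableWalks, mul_left_comm _ (2 : StableRing k p e), mul_left_comm _ (2 : StableRing k p e),
        two_mul, map_add, Finset.mul_sum, Finset.mul_sum, map_sum,
        Finset.sum_congr rfl fun c' hc' => ih c' (by
          have := Finset.mem_range.mp hc'
          omega), ← Finset.mul_sum]
      ring
  have hCval : C = (sq k (p ^ e) ^ (d + 1)).blocks - ((p ^ e : ℕ) : ℚ) ^ d := by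
    rw [hC, ← pow_succ, ← hX0, ← map_pow, ← map_pow, stableAlpha_sq]
  have hmain := hwalk d 0 (Nat.zero_le _)
  have h1 : x 0 ^ d * (g ^ d * symPair x m 0) = 2 * x m ^ (d + 1) := by
    rw [symPair_zero, ← hg0]
    generalize x 0 = z
    ring
  rw [h1, two_mul, map_add, ← hXm, ← map_pow, ← map_pow, hCval] at hmain
  have h2 := stableAlpha_sq_mul k p e m d
  rw [← hp] at h2
  rw [h2] at hmain
  linarith

/-- Weighted numbers of walks controlling the first Frobenius power. -/
def zigzagWalks (m : ℕ) : ℕ → ℕ → ℚ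
  | 0, _ => 1
  | i + 1, c => 2 * ∑ c' ∈ Finset.range (m - c), zigzagWalks m i c'

/-- Modulo δ_p the class for p is the central pair δ_m + δ_{m+1}, whose products with symmetric
pairs are given by `mul_pair_eq`. The lengths in a pair add up to p, so the values 1 - b/p sum to 1,
the starting value of `zigzagWalks`. -/
theorem blocks_sq_prime (m d : ℕ) (hp : p = 2 * m + 1) (hm : 0 < m) :
    ((sq k p ^ (d + 1)).blocks : ℚ) = (p : ℚ) ^ d + zigzagWalks m d 0 := by
  set π := toStable k p 1 with hπ
  set x : ℕ → StableRing k p 1 := fun a => π (dl k a) with hx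
  have hx0 : x 0 = 0 := by simp only [hx, dl_zero, map_zero]
  have hx1 : x 1 = 1 := by simp only [hx, dl_one, map_one]
  have hxl : x (2 * m + 1) = 0 := by
    have h := toStable_dl_mul k p 1 1
    have h2 : p ^ 1 * 1 = 2 * m + 1 := by rw [pow_one, mul_one, hp]
    simp only [hx, ← h2]
    exact h
  have hxs : ∀ b < 2 * m, x 2 * x (b + 1) = x (b + 2) + x b := by
    intro b hb
    have h := congrArg π (dl_two_mul_dl k p (b + 1) (by omega) (by omega))
    simpa [hx] using h
  have hP := fun {c} (hc : c < m) => mul_pair_eq hm hx0 hx1 hxl hxs hc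
  have hα : ∀ b, 0 < b → b ≤ p → stableAlpha k p 1 (x b) = 1 - (p : ℚ)⁻¹ * b := by
    intro b hb hbp
    have h := cl_frob_cyc_mul_add k p 0 b (by omega) hbp
    rw [mul_zero, zero_add, zero_add, dl_zero, smul_zero, add_zero, dl_one] at h
    simp only [hx]
    rw [dl, stableAlpha_cl, pow_one, h, ← dl, alpha_dl hb.ne', map_nsmul, alpha_one, nsmul_eq_mul,
      mul_one]
  have hα0 : stableAlpha k p 1 (x 0) = 0 := by rw [hx0, map_zero]
  have hE : π (cl (sq k p)) = x m + x (m + 1) := by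
    have h : cl (sq k p) = dl k m + dl k (m + 1) := by
      conv_lhs => rw [hp]
      exact cl_sq k m
    rw [h, map_add]
  have hwalk : ∀ i c, c < m → stableAlpha k p 1
      ((x m + x (m + 1)) ^ i * (x (m - c) + x (m + 1 + c))) = zigzagWalks m i c := by
    intro i
    induction i with
    | zero =>
      intro c hc
      have hp0 : (p : ℚ) ≠ 0 := Nat.cast_ne_zero.mpr (by omega)
      rw [pow_zero, one_mul, map_add, hα _ (by omega) (by omega), hα _ (by omega) (by omega),
        zigzagWalks, Nat.cast_sub hc.le]
      field_simp
      push_cast [hp]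
      ring
    | succ i ih =>
      intro c hc
      rw [pow_succ, mul_assoc, hP hc, mul_left_comm, two_mul, map_add, Finset.mul_sum, map_sum,
        Finset.sum_congr rfl fun c' hc' => ih c' (by
          have := Finset.mem_range.mp hc'
          omega), zigzagWalks, two_mul]
  have h := hwalk d 0 hm
  have h2 := stableAlpha_sq k p 1 d
  rw [pow_one, map_pow, map_pow, hE] at h2
  rw [Nat.sub_zero, add_zero, ← pow_succ, h2] at h
  linarith

end Recursion
end HilbertKunz
-- Polynomiality, growth and degrees
namespace HilbertKunz

section PolynomialCounts

/-- Faulhaber's formula. Coefficients in a general ℚ-algebra are needed because it is applied over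
ℚ[X], the inner variable being m. -/
theorem exists_sum_range_eval (R : Type*) [CommRing R] [Algebra ℚ R] (P : R[X]) :
    ∃ S : R[X], ∀ N : ℕ, S.eval (N : R) = ∑ i ∈ Finset.range N, P.eval (i : R) := by
  induction P using Polynomial.induction_on' with
  | add P Q hP hQ =>
    obtain ⟨S, hS⟩ := hP
    obtain ⟨T, hT⟩ := hQ
    exact ⟨S + T, fun N => by simp [hS, hT, Finset.sum_add_distrib]⟩
  | monomial n r =>
    refine ⟨C r * ((C (((n : ℚ) + 1)⁻¹) * (Polynomial.bernoulli (n + 1) -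
      C (_root_.bernoulli (n + 1)))).map (algebraMap ℚ R)), fun N => ?_⟩
    have h := Polynomial.sum_range_pow_eq_bernoulli_sub N n
    have h2 : ((C (((n : ℚ) + 1)⁻¹) * (Polynomial.bernoulli (n + 1) -
        C (_root_.bernoulli (n + 1)))).eval (N : ℚ)) = ∑ i ∈ Finset.range N, (i : ℚ) ^ n := by
      have hn : ((n : ℚ) + 1) ≠ 0 := by positivity
      rw [eval_mul, eval_C, eval_sub, eval_C, ← Nat.succ_eq_add_one, ← h, inv_mul_cancel_left₀ hn]
    rw [eval_mul, eval_C, eval_natCast_map, h2, map_sum, Finset.mul_sum]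
    simp [eval_monomial]

/-- A function of `m` and `c ≤ m` that is polynomial in both variables. -/
def IsPolynomialCount (F : ℕ → ℕ → ℚ) : Prop :=
  ∃ P : ℚ[X][X], ∀ m c : ℕ, 0 < m → c ≤ m → F m c = (P.map (evalRingHom (m : ℚ))).eval (c : ℚ)

theorem IsPolynomialCount.sum {F : ℕ → ℕ → ℚ} (hF : IsPolynomialCount F) (j : ℕ) :
    ∃ P : ℚ[X][X], ∀ m c : ℕ, 0 < m → c ≤ m → m - c + j ≤ m + 1 →
      ∑ c' ∈ Finset.range (m - c + j), F m c' = (P.map (evalRingHom (m : ℚ))).eval (c : ℚ) := by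
  obtain ⟨P, hP⟩ := hF
  obtain ⟨S, hS⟩ := exists_sum_range_eval ℚ[X] P
  -- The inner variable stands for m and the outer one for c, so this substitutes the upper limit m
  -- - c + j.
  refine ⟨S.comp (C X - X + C (j : ℚ[X])), fun m c hm hc hj => ?_⟩
  have h1 : ((m : ℚ) - c + j) = ((m - c + j : ℕ) : ℚ) := by push_cast [Nat.cast_sub hc]; ring
  rw [map_comp, eval_comp]
  simp only [Polynomial.map_add, Polynomial.map_sub, map_C, map_X, coe_evalRingHom, eval_X,
    eval_add, eval_sub, eval_C, eval_natCast]
  rw [h1, eval_natCast_map, hS, map_sum]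
  refine Finset.sum_congr rfl fun c' hc' => ?_
  have := Finset.mem_range.mp hc'
  rw [hP m c' hm (by omega), eval_natCast_map]

theorem isPolynomialCount_zigzagWalks (i : ℕ) :
    IsPolynomialCount fun m c => zigzagWalks m i c := by
  induction i with
  | zero => exact ⟨1, fun m c _ _ => by simp [zigzagWalks]⟩
  | succ i ih =>
    obtain ⟨P, hP⟩ := ih.sum 0
    refine ⟨2 * P, fun m c hm hc => ?_⟩
    beta_reduce
    rw [zigzagWalks]
    have := hP m c hm hc (by omega)
    rw [add_zero] at this
    simp [this]

theorem stableWalks_one (m c : ℕ) (hm : 0 < m) (hc : c ≤ m) :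
    stableWalks m 1 c = if c = 0 then 2 else 0 := by
  simp only [stableWalks, Finset.sum_ite_eq', Finset.mem_range, if_neg hm.ne, sub_zero]
  split_ifs with h1 h2
  · norm_num
  · omega
  · omega
  · norm_num

/-- Steps 0 and 1 are supported at c = m and c = 0, hence not polynomial in c; polynomiality starts
here. -/
theorem stableWalks_two (m c : ℕ) (hm : 0 < m) (hc : c ≤ m) : stableWalks m 2 c = 2 := by
  rw [stableWalks, stableWalks_one m 0 hm (Nat.zero_le _), Finset.sum_congr rfl fun c' hc' =>
    stableWalks_one m c' hm (by have := Finset.mem_range.mp hc'; omega)]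
  simp
  norm_num

theorem isPolynomialCount_stableWalks (i : ℕ) :
    IsPolynomialCount fun m c => stableWalks m (i + 2) c := by
  induction i with
  | zero => exact ⟨2, fun m c hm hc => by simp [stableWalks_two m c hm hc]⟩
  | succ i ih =>
    obtain ⟨P, hP⟩ := ih.sum 1
    obtain ⟨Q, hQ⟩ := ih
    refine ⟨2 * P - C (Q.eval 0), fun m c hm hc => ?_⟩
    change stableWalks m (i + 2 + 1) c = _
    rw [stableWalks]
    have h1 := hP m c hm hc (by omega)
    have h2 := hQ m 0 hm (Nat.zero_le _)
    rw [eval_natCast_map, Nat.cast_zero] at h2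
    simp [h1, h2]

theorem IsPolynomialCount.exists_eval {F : ℕ → ℕ → ℚ} (hF : IsPolynomialCount F) :
    ∃ P : ℚ[X], ∀ m : ℕ, 0 < m → P.eval ((2 * m + 1 : ℕ) : ℚ) = F m 0 := by
  obtain ⟨P, hP⟩ := hF
  refine ⟨(P.eval 0).comp (C (1 / 2) * (X - 1)), fun m hm => ?_⟩
  rw [hP m 0 hm (Nat.zero_le _), eval_natCast_map, eval_comp]
  simp

theorem exists_eval_eq_stableWalks (d : ℕ) :
    ∃ P : ℚ[X], ∀ m : ℕ, 0 < m → P.eval ((2 * m + 1 : ℕ) : ℚ) = stableWalks m d 0 / 2 := by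
  rcases d with - | - | d
  · exact ⟨0, fun m hm => by simp [stableWalks, hm.ne]⟩
  · exact ⟨1, fun m hm => by simp [stableWalks_one m 0 hm]⟩
  · obtain ⟨P, hP⟩ := (isPolynomialCount_stableWalks d).exists_eval
    exact ⟨C (1 / 2) * P, fun m hm => by rw [eval_mul, hP m hm, eval_C]; ring⟩

theorem zigzagWalks_bounds (m i c : ℕ) :
    0 ≤ zigzagWalks m i c ∧ zigzagWalks m i c ≤ (2 * m) ^ i := by
  induction i generalizing c with
  | zero => simp [zigzagWalks]
  | succ i ih =>
    rw [zigzagWalks]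
    refine ⟨mul_nonneg zero_le_two (Finset.sum_nonneg fun c' _ => (ih c').1), ?_⟩
    have h1 : ∑ c' ∈ Finset.range (m - c), zigzagWalks m i c' ≤
        ((m - c : ℕ) : ℚ) * (2 * m) ^ i := by
      simpa using Finset.sum_le_card_nsmul (Finset.range (m - c)) _ _ fun c' _ => (ih c').2
    have h2 : ((m - c : ℕ) : ℚ) ≤ m := by exact_mod_cast Nat.sub_le m c
    have h3 : (0 : ℚ) ≤ (2 * m) ^ i := by positivity
    rw [pow_succ]
    nlinarith [mul_le_mul_of_nonneg_right h2 h3]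

/-- Splitting off c' = 0 turns the subtraction into a nonnegative sum of total weight 2(m - c) + 1.
-/
theorem stableWalks_bounds (m i c : ℕ) (hm : 0 < m) (hc : c ≤ m) :
    0 ≤ stableWalks m (i + 1) c ∧ stableWalks m (i + 1) c ≤ 2 * (2 * m + 1) ^ i := by
  induction i generalizing c with
  | zero =>
    rw [stableWalks_one m c hm hc]
    split_ifs <;> norm_num
  | succ i ih =>
    have hnn : ∀ c' ∈ Finset.range (m - c), 0 ≤ stableWalks m (i + 1) (c' + 1) := fun c' hc' =>
      (ih (c' + 1) (by have := Finset.mem_range.mp hc'; omega)).1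
    have hle : ∀ c' ∈ Finset.range (m - c),
        stableWalks m (i + 1) (c' + 1) ≤ 2 * (2 * m + 1) ^ i := fun c' hc' =>
      (ih (c' + 1) (by have := Finset.mem_range.mp hc'; omega)).2
    have h0 := ih 0 (Nat.zero_le _)
    have h1 : ∑ c' ∈ Finset.range (m - c), stableWalks m (i + 1) (c' + 1) ≤
        ((m - c : ℕ) : ℚ) * (2 * (2 * m + 1) ^ i) := by
      simpa using Finset.sum_le_card_nsmul (Finset.range (m - c)) _ _ hle
    have h2 : ((m - c : ℕ) : ℚ) ≤ m := by exact_mod_cast Nat.sub_le m c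
    have h3 : (0 : ℚ) ≤ 2 * (2 * m + 1) ^ i := by positivity
    have h4 := Finset.sum_nonneg hnn
    rw [stableWalks, Finset.sum_range_succ']
    constructor
    · linarith [h0.1]
    · rw [pow_succ]
      nlinarith [mul_le_mul_of_nonneg_right h2 h3, h0.2]

theorem stableWalks_le (m d : ℕ) (hm : 0 < m) :
    0 ≤ stableWalks m d 0 / 2 ∧ stableWalks m d 0 / 2 ≤ ((2 * m + 1 : ℕ) : ℚ) ^ d / 3 := by
  rcases d with - | d
  · simp [stableWalks, hm.ne]
  · obtain ⟨h1, h2⟩ := stableWalks_bounds m d 0 hm (Nat.zero_le _)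
    refine ⟨by linarith, ?_⟩
    have h3 : (1 : ℚ) ≤ m := by exact_mod_cast hm
    have h4 : (0 : ℚ) ≤ (2 * m + 1) ^ d := by positivity
    rw [pow_succ]
    push_cast
    nlinarith

/-- If the degrees of P and X^d differed, the quotient of the smaller by the larger would tend to 0
along the odd integers, against the bounds. -/
theorem degree_eq_of_bounds (P : ℚ[X]) (d : ℕ)
    (h : ∀ m : ℕ, 0 < m → ((2 * m + 1 : ℕ) : ℚ) ^ d ≤ 2 * P.eval ((2 * m + 1 : ℕ) : ℚ) ∧
      P.eval ((2 * m + 1 : ℕ) : ℚ) ≤ 2 * ((2 * m + 1 : ℕ) : ℚ) ^ d) : P.degree = d := by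
  have hx : Tendsto (fun m : ℕ => ((2 * m + 1 : ℕ) : ℚ)) atTop atTop :=
    tendsto_natCast_atTop_atTop.comp
      (tendsto_atTop_mono (fun m => by omega : ∀ m : ℕ, m ≤ 2 * m + 1) tendsto_id)
  have key : ∀ A B : ℚ[X], A.degree < B.degree →
      (∀ m : ℕ, 0 < m → 0 < B.eval ((2 * m + 1 : ℕ) : ℚ) ∧
        B.eval ((2 * m + 1 : ℕ) : ℚ) ≤ 2 * A.eval ((2 * m + 1 : ℕ) : ℚ)) → False := by
    intro A B hAB hm
    have h1 := (Polynomial.div_tendsto_atTop_zero_of_degree_lt A B hAB).comp hx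
    have h2 := h1.eventually (gt_mem_nhds (show (0 : ℚ) < 1 / 2 by norm_num))
    obtain ⟨m, hm1, hm2⟩ := (h2.and (eventually_gt_atTop 0)).exists
    obtain ⟨h3, h4⟩ := hm m hm2
    simp only [Function.comp_apply] at hm1
    rw [div_lt_iff₀ h3] at hm1
    linarith
  have hpos : ∀ m : ℕ, 0 < ((2 * m + 1 : ℕ) : ℚ) ^ d := fun m => by positivity
  rcases lt_trichotomy P.degree (d : WithBot ℕ) with h1 | h1 | h1
  · exfalso
    refine key P (X ^ d) (by rwa [degree_X_pow]) fun m hm => ?_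
    rw [eval_pow, eval_X]
    exact ⟨hpos m, (h m hm).1⟩
  · exact h1
  · exfalso
    refine key (X ^ d) P (by rwa [degree_X_pow]) fun m hm => ?_
    rw [eval_pow, eval_X]
    exact ⟨by linarith [hpos m, (h m hm).1], (h m hm).2⟩

/-- After division by x^e the recursion is affine with slope w/x < 1 and fixed point L. -/
theorem tendsto_of_affine_recursion {a : ℕ → ℝ} {x w u : ℝ} (hx : 0 < x) (hw : 0 ≤ w)
    (hwx : w < x) (h : ∀ e, a (e + 1) = x ^ e * (x + u) + w * (a e - x ^ e)) :
    Tendsto (fun e => a e / x ^ e) atTop (𝓝 ((x + u - w) / (x - w))) := by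
  set L := (x + u - w) / (x - w) with hL
  have hxw : x - w ≠ 0 := (sub_pos.mpr hwx).ne'
  have hb : ∀ e, a e / x ^ e = L + (w / x) ^ e * (a 0 - L) := by
    intro e
    induction e with
    | zero => simp
    | succ e ih =>
      have hxe : x ^ e ≠ 0 := by positivity
      have h1 : a e = x ^ e * (L + (w / x) ^ e * (a 0 - L)) := by
        rw [← ih, mul_div_cancel₀ _ hxe]
      have h2 : a (e + 1) / x ^ (e + 1) = (x + u + w * (L + (w / x) ^ e * (a 0 - L) - 1)) / x := by
        rw [h, h1, pow_succ]
        field_simp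
      have h3 : L * (x - w) = x + u - w := div_mul_cancel₀ _ hxw
      rw [h2, pow_succ]
      field_simp
      linear_combination -h3
  simp only [hb]
  have h4 : Tendsto (fun e => (w / x) ^ e) atTop (𝓝 0) :=
    tendsto_pow_atTop_nhds_zero_of_lt_one (by positivity) ((div_lt_one hx).mpr hwx)
  simpa using (h4.mul_const (a 0 - L)).const_add L

end PolynomialCounts

/-! ### The limit of the normalized block numbers -/

section Limit

theorem sq_one_pow_blocks (k : Type) [Field k] (n : ℕ) : ((sq k 1 ^ n).blocks : ℚ) = 1 := by
  have h := cl_sq k 0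
  rw [mul_zero, zero_add, dl_zero, dl_one, zero_add] at h
  rw [← alpha_cl, map_pow, h, one_pow, alpha_one]

/-- The asymptotics of the number of blocks, in the form required by the main theorem. -/
theorem exists_tendsto_blocks (d : ℕ) : ∃ f g : ℚ[X], f.degree = (d : WithBot ℕ) ∧
    g.degree = (d : WithBot ℕ) ∧ ∀ (p : ℕ) [Fact p.Prime], 2 < p → g.eval (p : ℚ) ≠ 0 ∧
      Tendsto (fun e => ((sq (ZMod p) (p ^ e) ^ (d + 1)).blocks : ℝ) / (p : ℝ) ^ (e * d)) atTop
        (𝓝 ((f.eval (p : ℚ) / g.eval (p : ℚ) : ℚ) : ℝ)) := by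
  obtain ⟨U, hU⟩ := (isPolynomialCount_zigzagWalks d).exists_eval
  obtain ⟨W, hW⟩ := exists_eval_eq_stableWalks d
  have hUb : ∀ m : ℕ, 0 < m → 0 ≤ U.eval ((2 * m + 1 : ℕ) : ℚ) ∧
      U.eval ((2 * m + 1 : ℕ) : ℚ) ≤ ((2 * m + 1 : ℕ) : ℚ) ^ d := by
    intro m hm
    obtain ⟨h1, h2⟩ := zigzagWalks_bounds m d 0
    rw [hU m hm]
    refine ⟨h1, h2.trans (pow_le_pow_left₀ (by positivity) ?_ _)⟩
    push_cast
    linarith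
  have hWb : ∀ m : ℕ, 0 < m → 0 ≤ W.eval ((2 * m + 1 : ℕ) : ℚ) ∧
      W.eval ((2 * m + 1 : ℕ) : ℚ) ≤ ((2 * m + 1 : ℕ) : ℚ) ^ d / 3 := by
    intro m hm
    rw [hW m hm]
    exact stableWalks_le m d hm
  have hpos : ∀ m : ℕ, 0 < ((2 * m + 1 : ℕ) : ℚ) ^ d := fun m => by positivity
  -- Numerator and denominator of the fixed point of the recursion, with x = p^d.
  refine ⟨X ^ d + U - W, X ^ d - W, degree_eq_of_bounds _ _ fun m hm => ?_,
    degree_eq_of_bounds _ _ fun m hm => ?_, fun p hp hp2 => ?_⟩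
  · rw [eval_sub, eval_add, eval_pow, eval_X]
    constructor <;> linarith [hUb m hm, hWb m hm, (hUb m hm).1, (hUb m hm).2, (hWb m hm).1,
      (hWb m hm).2, hpos m]
  · rw [eval_sub, eval_pow, eval_X]
    constructor <;> linarith [(hWb m hm).1, (hWb m hm).2, hpos m]
  · obtain ⟨m, hm⟩ := (Fact.out : p.Prime).odd_of_ne_two hp2.ne'
    have hm0 : 0 < m := by omega
    have hUp := hU m hm0
    have hWp := hW m hm0
    have hWb' := hWb m hm0
    have hpos' := hpos m
    rw [← hm] at hUp hWp hWb' hpos'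
    set w := W.eval (p : ℚ) with hw
    set u := U.eval (p : ℚ) with hu
    have hlt : w < (p : ℚ) ^ d := by linarith [hWb'.2]
    rw [eval_sub, eval_sub, eval_add, eval_pow, eval_X, ← hw, ← hu]
    refine ⟨by linarith, ?_⟩
    have hfirst : ((sq (ZMod p) p ^ (d + 1)).blocks : ℚ) = (p : ℚ) ^ d + u := by
      rw [blocks_sq_prime (ZMod p) p m d hm hm0, hUp]
    have hrec : ∀ e : ℕ, ((sq (ZMod p) (p ^ (e + 1)) ^ (d + 1)).blocks : ℚ) =
        ((p : ℚ) ^ d) ^ e * ((p : ℚ) ^ d + u) +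
          w * ((sq (ZMod p) (p ^ e) ^ (d + 1)).blocks - ((p : ℚ) ^ d) ^ e) := by
      intro e
      -- For e = 0 one has s = 0, outside `blocks_sq_prime_mul`; there the correction term vanishes,
      -- as a_0 = 1.
      rcases Nat.eq_zero_or_pos e with rfl | he
      · rw [zero_add, pow_one, hfirst, pow_zero, pow_zero, sq_one_pow_blocks]
        ring
      · obtain ⟨s, hs⟩ : Odd (p ^ e) := Odd.pow ⟨m, hm⟩
        have hs0 : 0 < s := by
          have : 1 < p ^ e := Nat.one_lt_pow he.ne' (by omega)
          omega
        rw [pow_succ p e, blocks_sq_prime_mul (ZMod p) p m e s d hm hm0 hs hs0, hfirst, ← hWp]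
        push_cast
        ring
    have := tendsto_of_affine_recursion (a := fun e => ((sq (ZMod p) (p ^ e) ^ (d + 1)).blocks : ℝ))
      (x := (p : ℝ) ^ d) (w := (w : ℝ)) (u := (u : ℝ)) (by exact_mod_cast hpos')
      (by exact_mod_cast hWb'.1) (by exact_mod_cast hlt) (fun e => by exact_mod_cast hrec e)
    convert this using 2
    · rw [← pow_mul, mul_comm]
    · push_cast
      rfl

end Limit
end HilbertKunz
-- The quadric on truncated polynomial rings
namespace HilbertKunz

section TruncMvPoly

open scoped TensorProduct

/-- The truncated polynomial ring `k[x_1, ..., x_n] / (x_1 ^ q, ..., x_n ^ q)`. -/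
def TruncMvPoly (k : Type) [Field k] (n q : ℕ) : Type :=
  MvPolynomial (Fin n) k ⧸ Ideal.span (Set.range fun i : Fin n => (MvPolynomial.X i ^ q :
    MvPolynomial (Fin n) k))

namespace TruncMvPoly

variable (k : Type) [Field k] (n q : ℕ)

noncomputable instance : CommRing (TruncMvPoly k n q) := inferInstanceAs (CommRing (_ ⧸ _))

noncomputable instance : Algebra k (TruncMvPoly k n q) := inferInstanceAs (Algebra k (_ ⧸ _))

/-- The quotient map. -/
noncomputable def mk : MvPolynomial (Fin n) k →ₐ[k] TruncMvPoly k n q :=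
  Ideal.Quotient.mkₐ k _

theorem mk_surjective : Function.Surjective (mk k n q) := Ideal.Quotient.mk_surjective

variable {n} in
/-- The class of a variable. -/
noncomputable def x (i : Fin n) : TruncMvPoly k n q := mk k n q (MvPolynomial.X i)

theorem x_pow (i : Fin n) : x k q i ^ q = 0 := by
  rw [x, ← map_pow]
  exact Ideal.Quotient.eq_zero_iff_mem.mpr (Ideal.subset_span ⟨i, rfl⟩)

variable {k n q}

/-- The universal property. -/
noncomputable def lift {B : Type*} [CommRing B] [Algebra k B] (b : Fin n → B)
    (hb : ∀ i, b i ^ q = 0) : TruncMvPoly k n q →ₐ[k] B :=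
  Ideal.Quotient.liftₐ _ (MvPolynomial.aeval b) fun a ha => by
    have : Ideal.span (Set.range fun i : Fin n => (MvPolynomial.X i ^ q :
        MvPolynomial (Fin n) k)) ≤ RingHom.ker (MvPolynomial.aeval (R := k) b) := by
      rw [Ideal.span_le]
      rintro _ ⟨i, rfl⟩
      simp [RingHom.mem_ker, hb]
    exact this ha

theorem lift_x {B : Type*} [CommRing B] [Algebra k B] (b : Fin n → B)
    (hb : ∀ i, b i ^ q = 0) (i : Fin n) : lift (k := k) b hb (x k q i) = b i :=
  MvPolynomial.aeval_X _ _

theorem algHom_ext {B : Type*} [CommRing B] [Algebra k B] {f g : TruncMvPoly k n q →ₐ[k] B}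
    (h : ∀ i, f (x k q i) = g (x k q i)) : f = g := by
  have : f.comp (mk k n q) = g.comp (mk k n q) := MvPolynomial.algHom_ext h
  ext a
  obtain ⟨a, rfl⟩ := mk_surjective k n q a
  exact DFunLike.congr_fun this a

variable (k n q)

/-- Splitting off the first variable. -/
noncomputable def succEquiv :
    TruncMvPoly k (n + 1) q ≃ₐ[k] TruncPoly k q ⊗[k] TruncMvPoly k n q :=
  AlgEquiv.ofAlgHom
    (lift (Fin.cons (TruncPoly.x k q ⊗ₜ 1) fun i => 1 ⊗ₜ x k q i) (by
      intro i
      refine Fin.cases ?_ (fun i => ?_) i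
      · simp [TruncPoly.x_pow, Algebra.TensorProduct.tmul_pow]
      · simp [x_pow, Algebra.TensorProduct.tmul_pow]))
    (Algebra.TensorProduct.lift
      (AdjoinRoot.liftAlgHom _ (Algebra.ofId k _) (x k q (0 : Fin (n + 1)))
        (by rw [eval₂_X_pow, x_pow]))
      (lift (fun i => x k q i.succ) fun i => x_pow k (n + 1) q i.succ)
      fun _ _ => Commute.all _ _)
    (by
      apply Algebra.TensorProduct.ext
      · apply AdjoinRoot.algHom_ext
        simp [lift_x, TruncPoly.x]
      · apply algHom_ext
        intro i
        simp [lift_x])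
    (by
      apply algHom_ext
      intro i
      refine Fin.cases ?_ (fun i => ?_) i
      · simp [lift_x, TruncPoly.x]
      · simp [lift_x])

theorem succEquiv_zero : succEquiv k n q (x k q 0) = TruncPoly.x k q ⊗ₜ 1 := by
  simp [succEquiv, lift_x]

theorem succEquiv_succ (i : Fin n) : succEquiv k n q (x k q i.succ) = 1 ⊗ₜ x k q i := by
  simp [succEquiv, lift_x]

/-- Without variables nothing is added to the base field. -/
noncomputable def zeroEquiv : TruncMvPoly k 0 q ≃ₐ[k] k :=
  AlgEquiv.ofAlgHom (lift Fin.elim0 fun i => i.elim0) (Algebra.ofId k _)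
    (by ext) (algHom_ext fun i => i.elim0)

instance finite : Module.Finite k (TruncMvPoly k n q) := by
  induction n with
  | zero => exact Module.Finite.equiv (zeroEquiv k q).symm.toLinearEquiv
  | succ n ih => exact Module.Finite.equiv (succEquiv k n q).symm.toLinearEquiv

/-- The quadric `∑ x_i ^ 2` acting on the truncated polynomial ring. -/
noncomputable def quadricAlg : MarkedAlg k where
  A := TruncMvPoly k n q
  t := ∑ i, x k q i ^ 2

/-- Splitting off one variable at a time, a sum of squares in separate variables acts as the
primitive T on a tensor product. -/
theorem mk_quadricAlg : IsoClass.mk (quadricAlg k n q) = sq k q ^ n := by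
  induction n with
  | zero =>
    refine IsoClass.sound ?_
    have key : zeroEquiv k q (∑ i, x k q i ^ 2) = 0 := by simp
    exact MarkedAlg.Equivalent.of_algEquiv (M := quadricAlg k 0 q) (N := MarkedAlg.unit k)
      (zeroEquiv k q) key
  | succ n ih =>
    rw [pow_succ', ← ih, sq, IsoClass.mk_mul_mk]
    refine IsoClass.sound ?_
    have key : succEquiv k n q (∑ i, x k q i ^ 2) =
        (TruncPoly.x k q ^ 2) ⊗ₜ 1 + 1 ⊗ₜ (∑ i, x k q i ^ 2) := by
      rw [Fin.sum_univ_succ, map_add, map_sum, map_pow, succEquiv_zero,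
        Algebra.TensorProduct.tmul_pow, one_pow, TensorProduct.tmul_sum]
      congr 1
      refine Finset.sum_congr rfl fun i _ => ?_
      rw [map_pow, succEquiv_succ, Algebra.TensorProduct.tmul_pow, one_pow]
    exact MarkedAlg.Equivalent.of_algEquiv (M := quadricAlg k (n + 1) q)
      (N := ((MarkedAlg.cyc k q).frob 2).tensor (quadricAlg k n q)) (succEquiv k n q) key

end TruncMvPoly

end TruncMvPoly

/-! ### Lengths as dimensions; truncated power series -/

section Length

/-- Over a local ring with residue field `k`, the length is the dimension over `k`. -/
theorem length_toNat_eq_finrank {k R M : Type*} [Field k] [CommRing R] [IsLocalRing R]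
    [Algebra k R] [AddCommGroup M] [Module R M] [Module k M] [IsScalarTower k R M]
    (h : Function.Surjective (algebraMap k (IsLocalRing.ResidueField R))) :
    (Module.length R M).toNat = Module.finrank k M := by
  have h' : Function.Surjective (algebraMap (IsLocalRing.ResidueField k)
      (IsLocalRing.ResidueField R)) := by
    intro y
    obtain ⟨c, rfl⟩ := h y
    exact ⟨algebraMap k _ c, (IsScalarTower.algebraMap_apply k (IsLocalRing.ResidueField k)
      (IsLocalRing.ResidueField R) c).symm⟩
  have h1 : Module.length (IsLocalRing.ResidueField k) (IsLocalRing.ResidueField R) = 1 := by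
    rw [Module.length_eq_of_surjective h', Module.length_eq_one]
  have h2 := IsLocalRing.length_restrictScalars k R M
  rw [h1, mul_one] at h2
  rw [← h2, Module.length_eq_rank, Cardinal.toNat_toENat, Module.finrank]

end Length

section PowerSeries

variable {n : ℕ} {k : Type*} [Field k] (q : ℕ)

theorem mem_span_X_pow_iff (f : MvPowerSeries (Fin n) k) :
    f ∈ Ideal.span (Set.range fun i => (MvPowerSeries.X i ^ q : MvPowerSeries (Fin n) k)) ↔
      ∀ e : Fin n →₀ ℕ, (∀ i, e i < q) → MvPowerSeries.coeff e f = 0 := by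
  constructor
  · intro hf e he
    obtain ⟨c, rfl⟩ := Ideal.mem_span_range_iff_exists_fun.mp hf
    rw [map_sum]
    exact Finset.sum_eq_zero fun i _ =>
      MvPowerSeries.X_pow_dvd_iff.mp (Dvd.intro_left _ rfl) e (he i)
  -- Induction on the set of variables still constrained: the part of f divisible by X_a^q is
  -- removed for one a at a time.
  · suffices H : ∀ (s : Finset (Fin n)) (f : MvPowerSeries (Fin n) k),
        (∀ e : Fin n →₀ ℕ, (∀ i ∈ s, e i < q) → MvPowerSeries.coeff e f = 0) →
        f ∈ Ideal.span (Set.range fun i => (MvPowerSeries.X i ^ q : MvPowerSeries (Fin n) k)) from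
      fun h => H Finset.univ f fun e he => h e fun i => he i (Finset.mem_univ i)
    intro s
    induction s using Finset.induction_on with
    | empty =>
      intro f hf
      have : f = 0 := MvPowerSeries.ext fun e => by simpa using hf e
      simp [this]
    | insert a s _ ih =>
      intro f hf
      let g : MvPowerSeries (Fin n) k := fun e => if e a < q then 0 else MvPowerSeries.coeff e f
      have hg : ∀ e, MvPowerSeries.coeff e g = if e a < q then 0 else MvPowerSeries.coeff e f :=
        fun _ => rfl
      have h1 : MvPowerSeries.X a ^ q ∣ g := MvPowerSeries.X_pow_dvd_iff.mpr fun e he => by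
        rw [hg, if_pos he]
      rw [← sub_add_cancel f g]
      refine Ideal.add_mem _ (ih _ fun e he => ?_)
        (Ideal.mem_of_dvd _ h1 (Ideal.subset_span ⟨a, rfl⟩))
      rw [map_sub, hg]
      split_ifs with hea
      · rw [sub_zero]
        exact hf e fun i hi => (Finset.mem_insert.mp hi).elim (fun h => h ▸ hea) (he i)
      · exact sub_self _

theorem mem_span_mvPolynomial_X_pow (P : MvPolynomial (Fin n) k)
    (h : ∀ e : Fin n →₀ ℕ, (∀ i, e i < q) → P.coeff e = 0) :
    P ∈ Ideal.span (Set.range fun i => (MvPolynomial.X i ^ q : MvPolynomial (Fin n) k)) := by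
  have h1 : (Set.range fun i => (MvPolynomial.X i ^ q : MvPolynomial (Fin n) k)) =
      (fun s => MvPolynomial.monomial s (1 : k)) '' Set.range fun i => Finsupp.single i q := by
    rw [← Set.range_comp]
    exact congrArg _ (funext fun i => MvPolynomial.X_pow_eq_monomial)
  rw [h1, MvPolynomial.mem_ideal_span_monomial_image]
  intro e he
  by_contra! hc
  refine MvPolynomial.mem_support_iff.mp he (h e fun i => ?_)
  by_contra! hi
  exact hc _ ⟨i, rfl⟩ (Finsupp.single_le_iff.mpr hi)

end PowerSeries

section Truncation

variable (k : Type) [Field k] (n q : ℕ)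

/-- The ideal `(x_1 ^ q, ..., x_n ^ q)` of `k[[x_1, ..., x_n]]`. -/
noncomputable def XPowIdeal : Ideal (MvPowerSeries (Fin n) k) :=
  Ideal.span (Set.range fun i => MvPowerSeries.X i ^ q)

/-- The map from polynomials to power series, modulo the `q`-th powers of the variables. -/
noncomputable def TruncMvPoly.toPowerSeries :
    TruncMvPoly k n q →ₐ[k] MvPowerSeries (Fin n) k ⧸ XPowIdeal k n q :=
  TruncMvPoly.lift (fun i => Ideal.Quotient.mk _ (MvPowerSeries.X i)) fun i => by
    rw [← map_pow]
    exact Ideal.Quotient.eq_zero_iff_mem.mpr (Ideal.subset_span ⟨i, rfl⟩)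

theorem TruncMvPoly.toPowerSeries_x (i : Fin n) :
    toPowerSeries k n q (x k q i) = Ideal.Quotient.mk _ (MvPowerSeries.X i) :=
  lift_x (q := q) _ _ _

theorem TruncMvPoly.toPowerSeries_mk (P : MvPolynomial (Fin n) k) :
    toPowerSeries k n q (mk k n q P) =
      Ideal.Quotient.mk _ (P : MvPowerSeries (Fin n) k) := by
  have : (toPowerSeries k n q).comp (mk k n q) =
      (Ideal.Quotient.mkₐ k (XPowIdeal k n q)).comp
        (MvPolynomial.coeToMvPowerSeries.algHom k) := by
    apply MvPolynomial.algHom_ext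
    intro i
    change toPowerSeries k n q (x k q i) = _
    rw [toPowerSeries_x]
    simp
  simpa using DFunLike.congr_fun this P

theorem TruncMvPoly.toPowerSeries_bijective : Function.Bijective (toPowerSeries k n q) := by
  constructor
  · rw [injective_iff_map_eq_zero]
    intro a ha
    obtain ⟨P, rfl⟩ := mk_surjective k n q a
    rw [toPowerSeries_mk, Ideal.Quotient.eq_zero_iff_mem, XPowIdeal, mem_span_X_pow_iff] at ha
    refine Ideal.Quotient.eq_zero_iff_mem.mpr (mem_span_mvPolynomial_X_pow q P fun e he => ?_)
    simpa using ha e he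
  · intro b
    obtain ⟨f, rfl⟩ := Ideal.Quotient.mk_surjective b
    refine ⟨mk k n q (MvPowerSeries.trunc' k (Finsupp.equivFunOnFinite.symm fun _ => q - 1) f), ?_⟩
    rw [toPowerSeries_mk, Ideal.Quotient.eq, XPowIdeal, mem_span_X_pow_iff]
    intro e he
    rw [map_sub, MvPolynomial.coeff_coe, MvPowerSeries.coeff_trunc', if_pos, sub_self]
    intro i
    exact Nat.le_sub_one_of_lt (he i)

/-- The two quotients commute: dividing by the q-th powers first replaces power series by truncated
polynomials. -/
theorem finrank_quotient_quadric (d : ℕ) :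
    Module.finrank k (QuadricRing k d ⧸
      (XPowIdeal k (d + 1) q).map (Ideal.Quotient.mk (Ideal.span {quadric k d}))) =
    (sq k q ^ (d + 1)).blocks := by
  let φ := AlgEquiv.ofBijective _ (TruncMvPoly.toPowerSeries_bijective k (d + 1) q)
  let t : TruncMvPoly k (d + 1) q := ∑ i, TruncMvPoly.x k q i ^ 2
  have hφ : φ t = Ideal.Quotient.mk _ (quadric k d) := by
    rw [quadric, map_sum, map_sum]
    refine Finset.sum_congr rfl fun i _ => ?_
    rw [map_pow, map_pow]
    exact congrArg (· ^ 2) (TruncMvPoly.toPowerSeries_x k (d + 1) q i)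
  rw [← TruncMvPoly.mk_quadricAlg, IsoClass.blocks_mk]
  change _ = Module.finrank k (TruncMvPoly k (d + 1) q ⧸ Ideal.span {t})
  have e1 := DoubleQuot.quotQuotEquivCommₐ k (Ideal.span {quadric k d}) (XPowIdeal k (d + 1) q)
  have e2 := Ideal.quotientEquivAlg (Ideal.span {t})
    ((Ideal.span {quadric k d}).map (Ideal.Quotient.mk (XPowIdeal k (d + 1) q))) φ (by
      rw [Ideal.map_span, Ideal.map_span, Set.image_singleton, Set.image_singleton]
      exact congrArg (fun y => Ideal.span {y}) hφ.symm)
  exact (e1.trans e2.symm).toLinearEquiv.finrank_eq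

end Truncation

end HilbertKunz
-- Frobenius powers of the maximal ideal
namespace HilbertKunz

section FrobeniusPower

/-- Additivity of Frobenius puts the q-th power of a combination of generators in the ideal of their
q-th powers. -/
theorem frobeniusPower_span_range {R ι : Type*} [CommRing R] [Fintype ι] (p e : ℕ)
    [Fact p.Prime] [CharP R p] (y : ι → R) :
    frobeniusPower (Ideal.span (Set.range y)) (p ^ e) =
      Ideal.span (Set.range fun i => y i ^ p ^ e) := by
  apply le_antisymm
  · rw [frobeniusPower, Ideal.span_le]
    rintro _ ⟨a, ha, rfl⟩
    obtain ⟨c, rfl⟩ := Ideal.mem_span_range_iff_exists_fun.mp ha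
    change (∑ i, c i * y i) ^ p ^ e ∈ _
    rw [sum_pow_char_pow]
    refine Ideal.sum_mem _ fun i _ => ?_
    rw [mul_pow]
    exact Ideal.mul_mem_left _ _ (Ideal.subset_span ⟨i, rfl⟩)
  · rw [Ideal.span_le]
    rintro _ ⟨i, rfl⟩
    exact Ideal.subset_span ⟨y i, Ideal.subset_span ⟨i, rfl⟩, rfl⟩

theorem maximalIdeal_mvPowerSeries (n : ℕ) (k : Type*) [Field k] :
    IsLocalRing.maximalIdeal (MvPowerSeries (Fin n) k) =
      Ideal.span (Set.range MvPowerSeries.X) := by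
  ext f
  have h := mem_span_X_pow_iff 1 f
  simp only [pow_one] at h
  rw [show (Set.range MvPowerSeries.X : Set (MvPowerSeries (Fin n) k)) =
    Set.range fun i => MvPowerSeries.X i from rfl, h, IsLocalRing.mem_maximalIdeal,
    mem_nonunits_iff, MvPowerSeries.isUnit_iff_constantCoeff, isUnit_iff_ne_zero, not_not,
    ← MvPowerSeries.coeff_zero_eq_constantCoeff_apply]
  constructor
  · intro h e he
    rwa [show e = 0 from Finsupp.ext fun i => Nat.lt_one_iff.mp (he i)]
  · exact fun h => h 0 fun i => by simp

variable (k : Type) [Field k] (d : ℕ)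

theorem maximalIdeal_quadricRing :
    IsLocalRing.maximalIdeal (QuadricRing k d) =
      Ideal.span (Set.range fun i => Ideal.Quotient.mk (Ideal.span {quadric k d})
        (MvPowerSeries.X i)) := by
  have hs : Function.Surjective (Ideal.Quotient.mk (Ideal.span {quadric k d})) :=
    Ideal.Quotient.mk_surjective
  have h := IsLocalRing.eq_maximalIdeal (Ideal.comap_isMaximal_of_surjective _ hs
    (K := IsLocalRing.maximalIdeal (QuadricRing k d)))
  rw [← Ideal.map_comap_of_surjective _ hs (IsLocalRing.maximalIdeal (QuadricRing k d)), h,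
    maximalIdeal_mvPowerSeries, Ideal.map_span, ← Set.range_comp]
  rfl

theorem charP_quadricRing (p : ℕ) [CharP k p] : CharP (QuadricRing k d) p :=
  charP_of_injective_algebraMap (algebraMap k (QuadricRing k d)).injective p

theorem frobeniusPower_maximalIdeal_quadricRing (p e : ℕ) [Fact p.Prime] [CharP k p] :
    frobeniusPower (IsLocalRing.maximalIdeal (QuadricRing k d)) (p ^ e) =
      (XPowIdeal k (d + 1) (p ^ e)).map (Ideal.Quotient.mk (Ideal.span {quadric k d})) := by
  have := charP_quadricRing k d p
  rw [maximalIdeal_quadricRing, frobeniusPower_span_range, XPowIdeal, Ideal.map_span,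
    ← Set.range_comp]
  exact congrArg (fun f => Ideal.span (Set.range f)) (funext fun i => (map_pow _ _ _).symm)

theorem residueField_quadricRing_surjective :
    Function.Surjective (algebraMap k (IsLocalRing.ResidueField (QuadricRing k d))) := by
  intro y
  obtain ⟨y, rfl⟩ := IsLocalRing.residue_surjective y
  obtain ⟨f, rfl⟩ := Ideal.Quotient.mk_surjective y
  refine ⟨MvPowerSeries.constantCoeff f, ?_⟩
  have h1 : f - MvPowerSeries.C (MvPowerSeries.constantCoeff f) ∈
      IsLocalRing.maximalIdeal (MvPowerSeries (Fin (d + 1)) k) := by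
    rw [IsLocalRing.mem_maximalIdeal, mem_nonunits_iff, MvPowerSeries.isUnit_iff_constantCoeff]
    simp
  rw [maximalIdeal_mvPowerSeries] at h1
  have h2 := Ideal.mem_map_of_mem (Ideal.Quotient.mk (Ideal.span {quadric k d})) h1
  rw [Ideal.map_span, ← Set.range_comp] at h2
  have h3 : Ideal.Quotient.mk (Ideal.span {quadric k d})
      (f - MvPowerSeries.C (MvPowerSeries.constantCoeff f)) ∈
        IsLocalRing.maximalIdeal (QuadricRing k d) := by
    rw [maximalIdeal_quadricRing]
    exact h2
  rw [← IsLocalRing.residue_eq_zero_iff, map_sub, map_sub, sub_eq_zero] at h3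
  exact h3.symm

theorem length_quadricRing (p e : ℕ) [Fact p.Prime] [CharP k p] :
    (Module.length (QuadricRing k d) (QuadricRing k d ⧸
      frobeniusPower (IsLocalRing.maximalIdeal (QuadricRing k d)) (p ^ e))).toNat =
    (sq k (p ^ e) ^ (d + 1)).blocks := by
  rw [length_toNat_eq_finrank (residueField_quadricRing_surjective k d),
    frobeniusPower_maximalIdeal_quadricRing, finrank_quotient_quadric]

end FrobeniusPower

/-! ### Dimension of the quadric ring -/

section Dimension

/-- The variable is regular and lies in the Jacobson radical, so dividing by it lowers the dimension
by exactly one. -/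
theorem ringKrullDim_powerSeries (R : Type*) [CommRing R] [IsNoetherianRing R] :
    ringKrullDim (PowerSeries R) = ringKrullDim R + 1 := by
  have h1 : IsSMulRegular (PowerSeries R) (PowerSeries.X : PowerSeries R) := by
    intro a b h
    exact PowerSeries.X_mul_cancel h
  have h2 : (PowerSeries.X : PowerSeries R) ∈ Ring.jacobson (PowerSeries R) := by
    rw [← Ideal.jacobson_bot, Ideal.mem_jacobson_bot]
    intro y
    simp [PowerSeries.isUnit_iff_constantCoeff]
  rw [← ringKrullDim_quotient_span_singleton_succ_eq_ringKrullDim_of_mem_jacobson h1 h2]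
  have h3 : Function.Surjective (PowerSeries.constantCoeff (R := R)) :=
    fun r => ⟨PowerSeries.C r, by simp⟩
  have h4 : RingHom.ker (PowerSeries.constantCoeff (R := R)) = Ideal.span {PowerSeries.X} := by
    ext f
    rw [Ideal.mem_span_singleton, PowerSeries.X_dvd_iff, RingHom.mem_ker]
  rw [← h4, ringKrullDim_eq_of_ringEquiv (RingHom.quotientKerEquivOfSurjective h3)]

theorem ringKrullDim_mvPowerSeries (k : Type*) [Field k] (n : ℕ) :
    ringKrullDim (MvPowerSeries (Fin n) k) = n := by
  induction n with
  | zero =>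
    rw [ringKrullDim_eq_of_ringEquiv (MvPowerSeries.isEmptyEquiv (σ := Fin 0) (R := k)).toRingEquiv]
    simp
  | succ n ih =>
    rw [ringKrullDim_eq_of_ringEquiv (MvPowerSeries.finSuccEquiv k n).toRingEquiv,
      ringKrullDim_powerSeries, ih]
    simp

theorem quadric_ne_zero (k : Type*) [Field k] (d : ℕ) : quadric k d ≠ 0 := by
  intro h
  have := congrArg (MvPowerSeries.coeff (Finsupp.single 0 2)) h
  simp [quadric, MvPowerSeries.coeff_X_pow, Finsupp.single_left_inj] at this

theorem dim_quadricRing (k : Type*) [Field k] (d : ℕ) : dim (QuadricRing k d) = d := by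
  have h := ringKrullDim_quotient_span_singleton_succ_eq_ringKrullDim_of_mem_nonZeroDivisors
    (mem_nonZeroDivisors_of_ne_zero (quadric_ne_zero k d))
    ((IsLocalRing.mem_maximalIdeal _).mpr (quadric_not_isUnit k d))
  rw [ringKrullDim_mvPowerSeries] at h
  have h' : ringKrullDim (QuadricRing k d) = d := by
    refine ENat.WithBot.add_one_cancel.mp ?_
    rw [h, Nat.cast_succ]
  simp [dim, h']

end Dimension

theorem hkSeq_quadricRing (p : ℕ) [Fact p.Prime] (d : ℕ) :
    hkSeq (QuadricRing (ZMod p) d) = fun e =>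
      ((sq (ZMod p) (p ^ e) ^ (d + 1)).blocks : ℝ) / (p : ℝ) ^ (e * d) := by
  have := charP_quadricRing (ZMod p) d p
  funext e
  rw [hkSeq, ringChar.eq (QuadricRing (ZMod p) d) p, length_quadricRing, dim_quadricRing]

end HilbertKunz

theorem mainTheorem3 (d : ℕ) :
    ∃ f g : ℚ[X], f.degree = (d : WithBot ℕ) ∧ g.degree = (d : WithBot ℕ) ∧
      ∀ (p : ℕ) [Fact p.Prime], 2 < p →
        Tendsto (HilbertKunz.hkSeq (HilbertKunz.QuadricRing (ZMod p) d)) atTop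
          (𝓝 (HilbertKunz.eHK (HilbertKunz.QuadricRing (ZMod p) d))) ∧
        g.eval (p : ℚ) ≠ 0 ∧
        HilbertKunz.eHK (HilbertKunz.QuadricRing (ZMod p) d) =
          ((f.eval (p : ℚ) / g.eval (p : ℚ) : ℚ) : ℝ) := by
  obtain ⟨f, g, hf, hg, h⟩ := HilbertKunz.exists_tendsto_blocks d
  refine ⟨f, g, hf, hg, fun p _ hp => ?_⟩
  obtain ⟨h1, h2⟩ := h p hp
  rw [← HilbertKunz.hkSeq_quadricRing] at h2
  have h3 : HilbertKunz.eHK (HilbertKunz.QuadricRing (ZMod p) d) = _ := h2.limUnder_eq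
  exact ⟨h3 ▸ h2, h1, h3⟩
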